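/- Let $G=([n],E)$ be a simple graph in perfect elimination order, i.e. for every $i\in[n]$ the neighbors of $i$ in the subgraph $G_i$ of $G$ induced by $\{1,\dots,i\}$ form a clique. Let $\mathrm{AO}_G$ be the set of acyclic orientations of $G$. The flip graph on $\mathrm{AO}_G$ joins two acyclic orientations if they differ by reversing a single arc. The graphical zonotope is $Z(G)=\sum_{ij\in E}[e_i,e_j]\subset\mathbb{R}^n$ (Minkowski sum of segments); its skeleton is the graph of its vertices and edges. For $D\in\mathrm{AO}_G$, the permutation $\pi_D$ of $[n]$ (in one-line notation) is defined recursively: $\pi_D$ is the empty permutation if $n=0$; if $n\ge 1$, let $D_{n-1}$ be the subdigraph of $D$ induced by $[n-1]$, and obtain $\pi_D$ from $\pi_{D_{n-1}}$ by inserting the value $n$ (i) at the end, if $n$ is a sink of $D$; (ii) at the beginning, if $n$ is a source and not a sink of $D$; (iii) otherwise, directly before the unique out-neighbor of $n$ in the transitive reduction of $D$. Let $\Pi_G=\{\pi_D\mid D\in\mathrm{AO}_G\}$. A right (left) jump of a value $a$ by $d\ge 1$ steps in a permutation moves $a$ to the right (left) past the next $d$ entries, all of which must be smaller than $a$. A jump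 is minimal with respect to a set $L$ of permutations if every jump of the same value in the same direction by fewer steps gives a permutation not in $L$. Algorithm J with input $L$ and initial permutation $\pi_0\in L$ first visits $\pi_0$, and then repeats the following step: among the minimal jumps with respect to $L$ that lead from the most recently visited permutation to an unvisited permutation of $L$, take one of the largest possible value, and visit the resulting permutation; if there is no such jump, or if the direction of the jump of that value is ambiguous, terminate. A permutation $a_1\cdots a_n$ is peak-free if there is no $i$ with $a_{i-1}<a_i>a_{i+1}$. **Theorem.** The identity permutation, which is peak-free, belongs to $\Pi_G$. For every peak-free initial permutation $\pi_0\in\Pi_G$ (in particular for the identity permutation), Algorithm J with input $\Pi_G$ terminates, and the sequence of permutations it visits is $\pi_{D_1},\pi_{D_2},\dots,\pi_{D_N}$, where $D_1,\dots,D_N\in\mathrm{AO}_G$ is a Hamilton path in the flip graph on $\mathrm{AO}_G$. Equivalently, this is a Hamilton path on the skeleton of $Z(G)$: the map sending $D\in\mathrm{AO}_G$ to its in-degree sequence $(d^-_D(1),\dots,d^-_D(n))$ is a graph isomorphism from the flip graph onto the skeleton of $Z(G)$, and it carries $D_1,\dots,D_N$ to a Hamilton path of this skeleton. -/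

import Mathlib

namespace AcyclicGray

/-! ### Acyclic orientations and arc flips -/

/-- `D` is an orientation of `G`: every edge of `G` is directed in exactly one of two ways,
and `D` has no other arcs. -/
def IsOrientation {V : Type*} (G : SimpleGraph V) (D : Digraph V) : Prop :=
  (∀ u v, G.Adj u v ↔ D.Adj u v ∨ D.Adj v u) ∧ ∀ u v, D.Adj u v → ¬ D.Adj v u

/-- `D` has no directed cycle. -/
def IsAcyclicDigraph {V : Type*} (D : Digraph V) : Prop :=
  ∀ v, ¬ Relation.TransGen D.Adj v v

/-- The acyclic orientations of `G`. -/
abbrev AcyclicOrientation {V : Type*} (G : SimpleGraph V) : Type _ :=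
  {D : Digraph V // IsOrientation G D ∧ IsAcyclicDigraph D}

noncomputable instance {V : Type*} (G : SimpleGraph V) : DecidableEq (AcyclicOrientation G) :=
  Classical.decEq _

/-- The digraph obtained from `D` by replacing the arc `(u, v)` by the arc `(v, u)`. -/
def reverseArc {V : Type*} (D : Digraph V) (u v : V) : Digraph V where
  Adj x y := (x = v ∧ y = u) ∨ (D.Adj x y ∧ ¬ (x = u ∧ y = v))

/-- `D'` is obtained from `D` by reversing the direction of a single arc. -/
def IsArcFlip {V : Type*} (D D' : Digraph V) : Prop :=
  ∃ u v, D.Adj u v ∧ D' = reverseArc D u v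

theorem IsArcFlip.symm_of_isOrientation {V : Type*} {G : SimpleGraph V} {D D' : Digraph V}
    (hD : IsOrientation G D) (h : IsArcFlip D D') : IsArcFlip D' D := by
  obtain ⟨u, v, huv, rfl⟩ := h
  refine ⟨v, u, Or.inl ⟨rfl, rfl⟩, ?_⟩
  ext x y
  have h1 := hD.2 u v huv
  simp only [reverseArc]
  constructor
  · intro hxy
    by_cases hc : x = u ∧ y = v
    · exact Or.inl hc
    · refine Or.inr ⟨Or.inr ⟨hxy, hc⟩, ?_⟩
      rintro ⟨rfl, rfl⟩
      exact h1 hxy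
  · rintro (⟨rfl, rfl⟩ | ⟨h2 | h2, h3⟩)
    · exact huv
    · exact absurd h2 h3
    · exact h2.1

theorem IsArcFlip.ne_of_isOrientation {V : Type*} {G : SimpleGraph V} {D D' : Digraph V}
    (hD : IsOrientation G D) (h : IsArcFlip D D') : D ≠ D' := by
  obtain ⟨u, v, huv, rfl⟩ := h
  intro he
  apply hD.2 u v huv
  rw [he]
  exact Or.inl ⟨rfl, rfl⟩

/-- The flip graph on the acyclic orientations of `G`. -/
def flipGraph {V : Type*} (G : SimpleGraph V) : SimpleGraph (AcyclicOrientation G) where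
  Adj D D' := IsArcFlip D.1 D'.1
  symm := ⟨fun D _ h => h.symm_of_isOrientation D.2.1⟩
  loopless := ⟨fun D h => h.ne_of_isOrientation D.2.1 rfl⟩

/-! ### Perfect elimination order -/

/-- A vertex is simplicial if its neighborhood is a clique. -/
def IsSimplicial {V : Type*} (G : SimpleGraph V) (v : V) : Prop :=
  G.IsClique (G.neighborSet v)

/-- Every vertex `i` is simplicial in the subgraph induced by the vertices up to `i`. -/
def IsPerfectEliminationOrder {n : ℕ} (G : SimpleGraph (Fin n)) : Prop :=
  ∀ i : Fin n, IsSimplicial (G.induce (Set.Iic i)) ⟨i, Set.mem_Iic.2 le_rfl⟩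

/-! ### The permutation encoding

A permutation `a₁ ⋯ aₙ` is written in one-line notation, as a list that contains every element of
`Fin n` exactly once.  The ground set is `{0, …, n - 1}` in place of `{1, …, n}`. -/

/-- The transitive reduction of an acyclic digraph: the arcs that cannot be obtained by
transitivity. -/
def transitiveReduction {V : Type*} (D : Digraph V) : Digraph V where
  Adj u v := D.Adj u v ∧ ¬ ∃ w, Relation.TransGen D.Adj u w ∧ Relation.TransGen D.Adj w v

/-- The subdigraph induced by all vertices except the last one. -/
def deleteLast {n : ℕ} (D : Digraph (Fin (n + 1))) : Digraph (Fin n) where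
  Adj u v := D.Adj u.castSucc v.castSucc

/-- Insert the new largest value into the one-line notation `π` so that exactly `k` entries
stand to its left. -/
def insertLargest {n : ℕ} (π : List (Fin n)) (k : ℕ) : List (Fin (n + 1)) :=
  (π.map Fin.castSucc).insertIdx k (Fin.last n)

open Classical in
/-- The permutation `π_D`.  The largest vertex is inserted at the end if it is a sink, at the
beginning if it is a source (and not a sink), and otherwise directly in front of its out-neighbor in
the transitive reduction of `D` (which is unique if `D` is an acyclic orientation of a graph
in perfect elimination order). -/
noncomputable def encode : {n : ℕ} → Digraph (Fin n) → List (Fin n)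
  | 0, _ => []
  | n + 1, D =>
    let π := encode (deleteLast D)
    if ∀ v, ¬ D.Adj (Fin.last n) v then insertLargest π n
    else if ∀ v, ¬ D.Adj v (Fin.last n) then insertLargest π 0
    else insertLargest π ((π.map Fin.castSucc).idxOf
      (Classical.epsilon fun v => (transitiveReduction D).Adj (Fin.last n) v))

/-- `encode D` is the one-line notation of a permutation. -/
theorem encode_perm : ∀ {n : ℕ} (D : Digraph (Fin n)), (encode D).Perm (List.finRange n)
  | 0, _ => by simp [encode]
  | n + 1, D => by
    have ih := encode_perm (deleteLast D)
    have hlen : (encode (deleteLast D)).length = n := by simpa using ih.length_eq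
    have key : ∀ k ≤ n, (insertLargest (encode (deleteLast D)) k).Perm
        (List.finRange (n + 1)) := by
      intro k hk
      rw [List.finRange_succ_last]
      refine (List.perm_insertIdx _ _ (by simpa [hlen] using hk)).trans ?_
      exact ((ih.map _).cons _).trans (List.perm_append_singleton _ _).symm
    simp only [encode]
    split_ifs
    · exact key _ le_rfl
    · exact key _ (Nat.zero_le _)
    · exact key _ (by simpa [hlen] using List.idxOf_le_length (l := (encode (deleteLast D)).map Fin.castSucc))

/-- The set `Π_G` of the encodings of all acyclic orientations of `G`. -/
def encodings {n : ℕ} (G : SimpleGraph (Fin n)) : Set (List (Fin n)) :=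
  {π | ∃ D : AcyclicOrientation G, π = encode D.1}

/-! ### Algorithm J -/

inductive Direction
  | left
  | right

/-- `π'` is obtained from `π` by a jump of the value `a` by `d` steps in the given direction,
that is, `a` moves past `d > 0` consecutive entries, all of which are smaller than `a`. -/
def IsJump {n : ℕ} : Direction → Fin n → ℕ → List (Fin n) → List (Fin n) → Prop
  | .right, a, d, π, π' => ∃ u s v : List (Fin n), s.length = d ∧ 0 < d ∧ (∀ x ∈ s, x < a) ∧
      π = u ++ [a] ++ s ++ v ∧ π' = u ++ s ++ [a] ++ v
  | .left, a, d, π, π' => ∃ u s v : List (Fin n), s.length = d ∧ 0 < d ∧ (∀ x ∈ s, x < a) ∧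
      π = u ++ s ++ [a] ++ v ∧ π' = u ++ [a] ++ s ++ v

/-- A jump from `π` to `π'` that is minimal with respect to `L`: every jump of the same value in the
same direction by fewer steps leads out of `L`. -/
def IsMinimalJump {n : ℕ} (L : Set (List (Fin n))) (dir : Direction) (a : Fin n)
    (π π' : List (Fin n)) : Prop :=
  ∃ d, IsJump dir a d π π' ∧ ∀ d' < d, ∀ π'', IsJump dir a d' π π'' → π'' ∉ L

/-- A minimal jump of the value `a` from `π` to an element `π'` of `L` that is not in the list of
visited permutations. -/
def IsCandidate {n : ℕ} (L : Set (List (Fin n))) (visited : List (List (Fin n)))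
    (dir : Direction) (a : Fin n) (π π' : List (Fin n)) : Prop :=
  IsMinimalJump L dir a π π' ∧ π' ∈ L ∧ π' ∉ visited

/-- Step J2: `π'` is the next permutation to be visited after `π`.  It arises by a minimal jump of
the largest value `a` that has a minimal jump to an unvisited permutation of `L`, and the direction
of this jump is not ambiguous. -/
def IsNext {n : ℕ} (L : Set (List (Fin n))) (visited : List (List (Fin n)))
    (π π' : List (Fin n)) : Prop :=
  ∃ (a : Fin n) (dir : Direction), IsCandidate L visited dir a π π' ∧
    (∀ b, a < b → ∀ dir' π'', ¬ IsCandidate L visited dir' b π π'') ∧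
    ∀ dir' π'', IsCandidate L visited dir' a π π'' → dir' = dir

/-- `Run L π₀ l π`: Algorithm J with input `L` and initial permutation `π₀` reaches, after finitely
many steps, a state in which the permutations visited so far are `l`, in this order, and in which
`π` is the most recently visited one. -/
inductive Run {n : ℕ} (L : Set (List (Fin n))) (π₀ : List (Fin n)) :
    List (List (Fin n)) → List (Fin n) → Prop
  | init : Run L π₀ [π₀] π₀
  | step {l : List (List (Fin n))} {π π' : List (Fin n)} :
      Run L π₀ l π → IsNext L l π π' → Run L π₀ (l ++ [π']) π'

/-- Algorithm J with input `L` and initial permutation `π₀` terminates after having visited exactly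
the permutations in `l`, in this order. -/
def Generates {n : ℕ} (L : Set (List (Fin n))) (π₀ : List (Fin n)) (l : List (List (Fin n))) :
    Prop :=
  ∃ π, Run L π₀ l π ∧ ∀ π', ¬ IsNext L l π π'

/-- No three consecutive entries `x, y, z` satisfy `x < y > z`. -/
def PeakFree {n : ℕ} (π : List (Fin n)) : Prop :=
  ∀ x y z : Fin n, [x, y, z] <:+: π → ¬ (x < y ∧ z < y)

/-! ### The graphical zonotope -/

open Classical Pointwise in
/-- The graphical zonotope of `G`: the Minkowski sum, over all edges `ij` of `G`, of the segments
with endpoints `e_i` and `e_j`. -/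
noncomputable def graphicalZonotope {V : Type*} [Fintype V] (G : SimpleGraph V) : Set (V → ℝ) :=
  ∑ e ∈ G.edgeFinset, convexHull ℝ ((fun i : V => (Pi.single i 1 : V → ℝ)) '' {i | i ∈ e})

/-- The in-degree sequence of a digraph. -/
noncomputable def inDegrees {V : Type*} (D : Digraph V) : V → ℝ :=
  fun v => ({u | D.Adj u v}.ncard : ℝ)

/-- The skeleton of a polytope: its vertices are the vertices of the polytope, and two of them are
adjacent if the segment between them is a face. -/
def skeleton {E : Type*} [AddCommGroup E] [Module ℝ E] [TopologicalSpace E] (P : Set E) :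
    SimpleGraph (P.extremePoints ℝ) where
  Adj x y := x ≠ y ∧ IsExposed ℝ P (segment ℝ (x : E) (y : E))
  symm := ⟨fun x y h => ⟨h.1.symm, by rw [segment_symm]; exact h.2⟩⟩
  loopless := ⟨fun _ h => h.1 rfl⟩

end AcyclicGray

open AcyclicGray

/-! The theorem has two independent halves.

Polyhedral half: a point of the zonotope arises by splitting the unit weight of every edge between
its two directions and recording the inflow at each vertex (`mem_graphicalZonotope`). A linear
functional that is monotone along the arcs of an orientation `D` is maximal exactly at the
splittings that agree with `D` on every arc along which it strictly increases
(`face_graphicalZonotope`). A strictly increasing labelling of an acyclic `D` thus exposes a single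
point. A labelling that ties only on one flippable arc exposes the segment of that flip. Conversely,
at a vertex no edge is split and no directed cycle occurs, since either would leave room to move. An
exposed segment between two orientations is parallel to every edge on which they differ, so they
differ in one arc only.

Combinatorial half: induction on `n`. The neighbors of the last vertex form a clique, which an
acyclic orientation of the smaller graph orders linearly; extending it means cutting this chain into
in-neighbors and out-neighbors. The encoding represents each cut by one position (slot), so the
encodings of `G` are the insertions of the largest value into encodings of the smaller graph at
slots (`insertLargest_mem_encodings_iff`), and moving to the next slot flips one arc
(`isArcFlip_extendLast_of_lt`). Algorithm J is therefore a zigzag: the largest value sweeps through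
all slots from one end to the other (`run_sweep`), then, while it rests there, the algorithm makes
one step of its run on the smaller graph (`isNext_insertLargest_iff`). At an end slot the last
vertex is a source or a sink, so this step is again a flip. Peak-freeness puts the largest value at
an end initially, and recursively so. Determinism (`Generates.eq`) makes the constructed run the
only one. -/

namespace AcyclicGray

/-! ### The graphical zonotope and its skeleton -/

section Zonotope

variable {V : Type*} {G : SimpleGraph V} {D D' : Digraph V}

open Classical in
/-- A fractional orientation distributes every edge over its two directions. -/
def IsFractionalOrientation (G : SimpleGraph V) (t : V → V → ℝ) : Prop :=
  (∀ u v, 0 ≤ t u v) ∧ ∀ u v, t u v + t v u = if G.Adj u v then 1 else 0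

open Classical in
/-- The arc indicator of a digraph. -/
noncomputable def arcIndicator (D : Digraph V) : V → V → ℝ := fun u v => if D.Adj u v then 1 else 0

theorem IsOrientation.isFractionalOrientation (h : IsOrientation G D) :
    IsFractionalOrientation G (arcIndicator D) := by
  classical
  refine ⟨fun u v => ?_, fun u v => ?_⟩
  · unfold arcIndicator; split_ifs <;> norm_num
  · have h1 := h.1 u v
    have h2 := h.2 u v
    unfold arcIndicator
    by_cases ha : D.Adj u v <;> by_cases hb : D.Adj v u <;> simp_all

theorem IsFractionalOrientation.le_one {t : V → V → ℝ} (ht : IsFractionalOrientation G t)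
    (u v : V) : t u v ≤ 1 := by
  classical
  have h1 := ht.2 u v
  have h2 := ht.1 v u
  split_ifs at h1 <;> linarith

theorem IsFractionalOrientation.eq_zero_of_not_adj {t : V → V → ℝ}
    (ht : IsFractionalOrientation G t) {u v : V} (h : ¬ G.Adj u v) : t u v = 0 := by
  classical
  have h1 := ht.2 u v
  rw [if_neg h] at h1
  linarith [ht.1 u v, ht.1 v u]

theorem IsFractionalOrientation.add_eq_one {t : V → V → ℝ}
    (ht : IsFractionalOrientation G t) {u v : V} (h : G.Adj u v) : t u v + t v u = 1 := by
  classical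
  simpa [h] using ht.2 u v

theorem IsOrientation.eq_of_le (hD : IsOrientation G D) (hD' : IsOrientation G D')
    (h : ∀ u v, D.Adj u v → D'.Adj u v) : D = D' := by
  ext u v
  refine ⟨h u v, fun huv => ?_⟩
  rcases (hD.1 u v).1 ((hD'.1 u v).2 (Or.inl huv)) with h1 | h1
  · exact h1
  · exact absurd (h v u h1) (hD'.2 u v huv)

theorem arcIndicator_eq_one {u v : V} : arcIndicator D u v = 1 ↔ D.Adj u v := by
  simp [arcIndicator]

/-- Both factors are nonnegative on an arc of `D`, both are nonpositive on a reversed arc, and the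
second one vanishes off the edges. -/
theorem gap_term_nonneg (hD : IsOrientation G D) {t : V → V → ℝ}
    (ht : IsFractionalOrientation G t) {c : V → ℝ} (hc : ∀ u v, D.Adj u v → c u ≤ c v) (u v : V) :
    0 ≤ (c v - c u) * (arcIndicator D u v - t u v) := by
  by_cases h1 : D.Adj u v
  · have := ht.le_one u v
    exact mul_nonneg (by linarith [hc u v h1]) (by simp [arcIndicator, h1, this])
  · by_cases h2 : D.Adj v u
    · exact mul_nonneg_of_nonpos_of_nonpos (by linarith [hc v u h2])
        (by simp [arcIndicator, h1, ht.1 u v])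
    · have h3 : ¬ G.Adj u v := by rw [hD.1]; tauto
      simp [arcIndicator, h1, ht.eq_zero_of_not_adj h3]

open Classical in
theorem mem_edgeSegment {a b : V} {p : V → ℝ} :
    p ∈ convexHull ℝ ((fun i : V => (Pi.single i 1 : V → ℝ)) '' {i | i ∈ s(a, b)}) ↔
      ∃ r s : ℝ, 0 ≤ r ∧ 0 ≤ s ∧ r + s = 1 ∧ r • Pi.single a 1 + s • Pi.single b 1 = p := by
  have : {i | i ∈ s(a, b)} = {a, b} := by ext; simp
  rw [this, Set.image_pair, convexHull_pair]
  rfl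

variable [Fintype V]

/-- The total weight entering each vertex. -/
def inflow (t : V → V → ℝ) : V → ℝ := fun v => ∑ u, t u v

theorem inflow_arcIndicator (D : Digraph V) : inflow (arcIndicator D) = inDegrees D := by
  classical
  ext v
  simp only [inflow, arcIndicator, inDegrees, Finset.sum_boole]
  rw [Set.ncard_eq_toFinset_card']
  congr 2
  ext u
  simp

-- Only edges through `w` contribute to coordinate `w`, and these are indexed by the neighbors of
-- `w`.
open Classical in
theorem sum_edgeFinset_apply (g : Sym2 V → V → ℝ)
    (hg : ∀ e ∈ G.edgeFinset, ∀ w ∉ e, g e w = 0) (w : V) :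
    ∑ e ∈ G.edgeFinset, g e w = ∑ u, if G.Adj u w then g s(u, w) w else 0 := by
  rw [← Finset.sum_filter]
  symm
  refine Finset.sum_of_injOn (fun u => s(u, w)) ?_ ?_ ?_ ?_
  · intro a _ b _ hab
    exact Sym2.congr_left.1 hab
  · intro a ha
    simpa using ha
  · intro e he hne
    by_contra h0
    have hw : w ∈ e := by
      by_contra hw
      exact h0 (hg e he w hw)
    obtain ⟨u, rfl⟩ := Sym2.mem_iff_exists.1 hw
    refine hne ⟨u, ?_, Sym2.eq_swap⟩
    simpa [G.adj_comm] using he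
  · intro u _
    rfl

theorem mem_graphicalZonotope {x : V → ℝ} :
    x ∈ graphicalZonotope G ↔ ∃ t, IsFractionalOrientation G t ∧ inflow t = x := by
  classical
  unfold graphicalZonotope
  rw [Set.mem_finsetSum]
  constructor
  · rintro ⟨g, hg, rfl⟩
    have key : ∀ a b, G.Adj a b → 0 ≤ g s(a, b) b ∧ g s(a, b) b + g s(a, b) a = 1 ∧
        ∀ w ∉ s(a, b), g s(a, b) w = 0 := by
      intro a b hab
      obtain ⟨r, s, hr, hs, hrs, he⟩ := mem_edgeSegment.1 (hg (i := s(a, b)) (by simpa using hab))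
      have hne := hab.ne
      rw [← he]
      refine ⟨?_, ?_, ?_⟩
      · simp [hne.symm, hs]
      · simp [hne, hne.symm]; linarith
      · intro w hw
        simp only [Sym2.mem_iff, not_or] at hw
        simp [hw.1, hw.2]
    refine ⟨fun u v => if G.Adj u v then g s(u, v) v else 0, ⟨?_, ?_⟩, ?_⟩
    · intro u v
      dsimp only
      split_ifs with h
      · exact (key u v h).1
      · exact le_rfl
    · intro u v
      dsimp only
      by_cases h : G.Adj u v
      · simp only [h, h.symm, if_true]
        rw [Sym2.eq_swap (a := v)]
        exact (key u v h).2.1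
      · have h' : ¬ G.Adj v u := fun h' => h h'.symm
        simp [h, h']
    · ext w
      rw [Finset.sum_apply, sum_edgeFinset_apply g]
      · rfl
      · intro e
        induction e with
        | h a b => intro he; exact (key a b (by simpa using he)).2.2
  · rintro ⟨t, ht, rfl⟩
    -- Each endpoint receives the weight directed towards it; the formula is symmetric, so it
    -- descends to unordered pairs.
    let g : Sym2 V → V → ℝ := Sym2.lift ⟨fun a b => t b a • Pi.single a 1 + t a b • Pi.single b 1,
      fun a b => add_comm _ _⟩
    have hg : ∀ a b, g s(a, b) = t b a • Pi.single a 1 + t a b • Pi.single b 1 := fun a b => rfl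
    refine ⟨g, ?_, ?_⟩
    · intro e
      induction e with
      | h a b =>
        intro he
        rw [mem_edgeSegment]
        refine ⟨_, _, ht.1 b a, ht.1 a b, ?_, (hg a b).symm⟩
        have : G.Adj b a := by simpa [G.adj_comm] using he
        simpa [this] using ht.2 b a
    · ext w
      rw [Finset.sum_apply, sum_edgeFinset_apply g]
      · refine Finset.sum_congr rfl fun u _ => ?_
        split_ifs with h
        · simp [hg, h.ne.symm]
        · have h1 := ht.2 u w
          rw [if_neg h] at h1
          linarith [ht.1 u w, ht.1 w u]
      · intro e
        induction e with
        | h a b =>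
          intro he w hw
          simp only [Sym2.mem_iff, not_or] at hw
          simp [hg, hw.1, hw.2]

theorem inDegrees_mem_graphicalZonotope (h : IsOrientation G D) :
    inDegrees D ∈ graphicalZonotope G :=
  mem_graphicalZonotope.2 ⟨_, h.isFractionalOrientation, inflow_arcIndicator D⟩

open Classical in
/-- Weight can be moved from an arc to the reverse arc. -/
theorem inflow_add_single_mem {t : V → V → ℝ} (ht : IsFractionalOrientation G t) {u v : V}
    {s : ℝ} (hs : 0 ≤ s) (hst : s ≤ t u v) :
    inflow t + s • (Pi.single u 1 - Pi.single v 1) ∈ graphicalZonotope G := by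
  refine mem_graphicalZonotope.2 ⟨fun x y => t x y + s * ((if x = v ∧ y = u then 1 else 0) -
    (if x = u ∧ y = v then 1 else 0)), ⟨?_, ?_⟩, ?_⟩
  · intro x y
    have h1 := ht.1 x y
    dsimp only
    by_cases hx : x = u ∧ y = v
    · obtain ⟨rfl, rfl⟩ := hx
      simp only [and_self, if_true]
      split_ifs <;> linarith
    · simp only [hx, if_false, sub_zero]
      split_ifs <;> linarith
  · intro x y
    rw [← ht.2 x y]
    simp only [and_comm (a := y = v), and_comm (a := y = u)]
    ring
  · ext y
    simp only [inflow, Finset.sum_add_distrib, ← Finset.mul_sum, Finset.sum_sub_distrib, Pi.add_apply,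
      Pi.smul_apply, Pi.sub_apply, smul_eq_mul, Pi.single_apply, ite_and, Finset.sum_ite_eq',
      Finset.mem_univ, if_true]

/-! ### Faces of the zonotope in directions compatible with an orientation -/

/-- Weighted sums of inflows compare arc by arc. -/
theorem two_mul_sum_inflow_sub {t t' : V → V → ℝ} (ht : IsFractionalOrientation G t)
    (ht' : IsFractionalOrientation G t') (c : V → ℝ) :
    2 * (∑ v, c v * inflow t v - ∑ v, c v * inflow t' v) =
      ∑ u, ∑ v, (c v - c u) * (t u v - t' u v) := by
  have h1 : ∑ v, c v * inflow t v - ∑ v, c v * inflow t' v =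
      ∑ u, ∑ v, c v * (t u v - t' u v) := by
    rw [Finset.sum_comm, ← Finset.sum_sub_distrib]
    refine Finset.sum_congr rfl fun v _ => ?_
    simp only [inflow, mul_sub, Finset.sum_sub_distrib, Finset.mul_sum]
  -- The difference `t - t'` is antisymmetric, because both splittings have the same total on every
  -- pair. This symmetrizes the sum and accounts for the factor 2.
  have h2 : ∑ u, ∑ v, c v * (t u v - t' u v) = - ∑ u, ∑ v, c u * (t u v - t' u v) := by
    rw [Finset.sum_comm, ← Finset.sum_neg_distrib]
    refine Finset.sum_congr rfl fun v _ => ?_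
    rw [← Finset.sum_neg_distrib]
    refine Finset.sum_congr rfl fun u _ => ?_
    have := ht.2 u v
    rw [← ht'.2 u v] at this
    linear_combination c v * this
  have h3 : ∑ u, ∑ v, (c v - c u) * (t u v - t' u v) =
      ∑ u, ∑ v, c v * (t u v - t' u v) - ∑ u, ∑ v, c u * (t u v - t' u v) := by
    simp only [sub_mul, Finset.sum_sub_distrib]
  rw [h3, h1]
  linarith

theorem sum_inflow_le (hD : IsOrientation G D) {t : V → V → ℝ}
    (ht : IsFractionalOrientation G t) {c : V → ℝ} (hc : ∀ u v, D.Adj u v → c u ≤ c v) :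
    ∑ v, c v * inflow t v ≤ ∑ v, c v * inDegrees D v := by
  have h := two_mul_sum_inflow_sub hD.isFractionalOrientation ht c
  have h2 := Finset.sum_nonneg fun u (_ : u ∈ Finset.univ) =>
    Finset.sum_nonneg fun v (_ : v ∈ Finset.univ) => gap_term_nonneg hD ht hc u v
  rw [inflow_arcIndicator] at h
  linarith

/-- The gap is half a sum of nonnegative terms, so equality makes each of them vanish: on every arc
either `c` ties or `t` agrees with `D`. -/
theorem sum_inflow_eq_iff (hD : IsOrientation G D) {t : V → V → ℝ}
    (ht : IsFractionalOrientation G t) {c : V → ℝ} (hc : ∀ u v, D.Adj u v → c u ≤ c v) :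
    ∑ v, c v * inflow t v = ∑ v, c v * inDegrees D v ↔
      ∀ u v, D.Adj u v → c u < c v → t u v = 1 := by
  have h := two_mul_sum_inflow_sub hD.isFractionalOrientation ht c
  rw [inflow_arcIndicator] at h
  have h1 : ∑ v, c v * inflow t v = ∑ v, c v * inDegrees D v ↔
      ∑ u, ∑ v, (c v - c u) * (arcIndicator D u v - t u v) = 0 := by
    constructor <;> intro h' <;> linarith
  rw [h1, Finset.sum_eq_zero_iff_of_nonneg fun u _ =>
    Finset.sum_nonneg fun v _ => gap_term_nonneg hD ht hc u v]
  simp only [Finset.mem_univ, true_imp_iff, Finset.sum_eq_zero_iff_of_nonneg fun v _ =>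
    gap_term_nonneg hD ht hc _ v]
  constructor
  · intro h' u v huv hlt
    rcases mul_eq_zero.1 (h' u v) with h0 | h0
    · linarith
    · simp [arcIndicator, huv] at h0; linarith
  · intro h' u v
    by_cases huv : D.Adj u v
    · rcases (hc u v huv).eq_or_lt with h0 | h0
      · simp [h0]
      · simp [arcIndicator, huv, h' u v huv h0]
    · by_cases hvu : D.Adj v u
      · rcases (hc v u hvu).eq_or_lt with h0 | h0
        · simp [h0]
        · have := h' v u hvu h0
          have h3 := ht.add_eq_one ((hD.1 v u).2 (Or.inl hvu))
          have h4 : t u v = 0 := by linarith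
          simp [arcIndicator, huv, h4]
      · have h3 : ¬ G.Adj u v := by rw [hD.1]; tauto
        simp [arcIndicator, huv, ht.eq_zero_of_not_adj h3]

/-- The face of the zonotope in a direction compatible with `D`. -/
theorem face_graphicalZonotope (hD : IsOrientation G D) {c : V → ℝ}
    (hc : ∀ u v, D.Adj u v → c u ≤ c v) :
    {x ∈ graphicalZonotope G | ∀ y ∈ graphicalZonotope G, ∑ v, c v * y v ≤ ∑ v, c v * x v} =
      {x | ∃ t, IsFractionalOrientation G t ∧ (∀ u v, D.Adj u v → c u < c v → t u v = 1) ∧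
        inflow t = x} := by
  ext x
  constructor
  · rintro ⟨hx, hmax⟩
    obtain ⟨t, ht, rfl⟩ := mem_graphicalZonotope.1 hx
    exact ⟨t, ht, (sum_inflow_eq_iff hD ht hc).1 ((sum_inflow_le hD ht hc).antisymm
      (hmax _ (inDegrees_mem_graphicalZonotope hD))), rfl⟩
  · rintro ⟨t, ht, h1, rfl⟩
    refine ⟨mem_graphicalZonotope.2 ⟨t, ht, rfl⟩, fun y hy => ?_⟩
    obtain ⟨t', ht', rfl⟩ := mem_graphicalZonotope.1 hy
    rw [(sum_inflow_eq_iff hD ht hc).2 h1]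
    exact sum_inflow_le hD ht' hc

theorem isExposed_of_eq_face {P B : Set (V → ℝ)} (c : V → ℝ)
    (h : {x ∈ P | ∀ y ∈ P, ∑ v, c v * y v ≤ ∑ v, c v * x v} = B) : IsExposed ℝ P B := by
  intro _
  refine ⟨∑ v, c v • ContinuousLinearMap.proj (R := ℝ) (φ := fun _ : V => ℝ) v, ?_⟩
  rw [← h]
  simp

/-! ### Vertices of the zonotope and acyclic orientations -/

/-- An acyclic digraph has a labelling that increases along its arcs. -/
theorem IsAcyclicDigraph.exists_increasing (h : IsAcyclicDigraph D) :
    ∃ c : V → ℝ, ∀ u v, D.Adj u v → c u < c v := by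
  -- The label counts proper ancestors. Along an arc from `u` to `v` it grows, since `u` is an
  -- ancestor of `v` but, by acyclicity, not of itself.
  refine ⟨fun v => ({u | Relation.TransGen D.Adj u v}.ncard : ℝ), fun u v huv => ?_⟩
  have hlt : {w | Relation.TransGen D.Adj w u}.ncard < {w | Relation.TransGen D.Adj w v}.ncard := by
    refine Set.ncard_lt_ncard ?_ (Set.toFinite _)
    refine ⟨fun w hw => Relation.TransGen.tail hw huv, fun hsub => ?_⟩
    exact h u (hsub (Relation.TransGen.single huv))
  exact Nat.cast_lt.2 hlt

/-- With the same in-degrees, `D'` also maximizes a functional that strictly increases along `D`,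
hence contains all arcs of `D`. -/
theorem inDegrees_injective (hD : IsOrientation G D) (hac : IsAcyclicDigraph D)
    (hD' : IsOrientation G D') (h : inDegrees D = inDegrees D') : D = D' := by
  obtain ⟨c, hc⟩ := hac.exists_increasing
  refine hD.eq_of_le hD' fun u v huv => ?_
  have := (sum_inflow_eq_iff hD hD'.isFractionalOrientation (c := c)
    fun u v huv => (hc u v huv).le).1 (by rw [inflow_arcIndicator, h]) u v huv (hc u v huv)
  exact arcIndicator_eq_one.1 this

/-- A strictly increasing labelling determines the splitting of every edge, so the face it exposes
is a point. -/
theorem inDegrees_mem_extremePoints (hD : IsOrientation G D) (hac : IsAcyclicDigraph D) :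
    inDegrees D ∈ (graphicalZonotope G).extremePoints ℝ := by
  obtain ⟨c, hc⟩ := hac.exists_increasing
  rw [← isExtreme_singleton]
  refine IsExposed.isExtreme (isExposed_of_eq_face c ?_)
  rw [face_graphicalZonotope hD fun u v huv => (hc u v huv).le]
  ext x
  simp only [Set.mem_ofPred_eq, Set.mem_singleton_iff]
  constructor
  · rintro ⟨t, ht, h1, rfl⟩
    rw [← inflow_arcIndicator]
    congr 1
    ext u v
    by_cases huv : D.Adj u v
    · rw [h1 u v huv (hc u v huv), arcIndicator_eq_one.2 huv]
    · by_cases hvu : D.Adj v u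
      · have h2 := h1 v u hvu (hc v u hvu)
        have h3 := ht.add_eq_one ((hD.1 v u).2 (Or.inl hvu))
        have h4 : t u v = 0 := by linarith
        simp [h4, arcIndicator, huv]
      · have h3 : ¬ G.Adj u v := by rw [hD.1]; tauto
        simp [arcIndicator, huv, ht.eq_zero_of_not_adj h3]
  · rintro rfl
    exact ⟨_, hD.isFractionalOrientation, fun u v huv _ => arcIndicator_eq_one.2 huv,
      inflow_arcIndicator D⟩

/-- A fractional orientation whose inflow is a vertex of the zonotope is integral. -/
theorem eq_zero_or_one_of_extreme {t : V → V → ℝ} (ht : IsFractionalOrientation G t)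
    (hx : inflow t ∈ (graphicalZonotope G).extremePoints ℝ) (u v : V) :
    t u v = 0 ∨ t u v = 1 := by
  classical
  by_contra! hcon
  have h0 : 0 < t u v := lt_of_le_of_ne (ht.1 u v) hcon.1.symm
  have hadj : G.Adj u v := by
    by_contra hna
    exact hcon.1 (ht.eq_zero_of_not_adj hna)
  have h1 : 0 < t v u := by
    have := ht.add_eq_one hadj
    have := lt_of_le_of_ne (ht.le_one u v) hcon.2
    linarith
  -- Pushing `s` along a split edge in either direction stays in the zonotope and has the given
  -- point as midpoint.
  obtain ⟨s, hs, hs1, hs2⟩ : ∃ s : ℝ, 0 < s ∧ s ≤ t u v ∧ s ≤ t v u :=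
    ⟨min (t u v) (t v u), lt_min h0 h1, min_le_left _ _, min_le_right _ _⟩
  have key := (mem_extremePoints.1 hx).2 _ (inflow_add_single_mem ht hs.le hs1) _
    (inflow_add_single_mem ht hs.le hs2) ?_
  · have := congrFun key.1 u
    simp [hadj.ne, hs.ne'] at this
  · refine ⟨1 / 2, 1 / 2, by norm_num, by norm_num, by norm_num, ?_⟩
    ext w
    simp
    ring

open Classical in
/-- Sending one unit along a directed walk. -/
theorem exists_flow_of_transGen {a b : V} (h : Relation.TransGen D.Adj a b) :
    ∃ f : V → V → ℝ, (∀ u v, 0 ≤ f u v) ∧ (∀ u v, f u v ≠ 0 → D.Adj u v) ∧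
      (∃ u v, 0 < f u v) ∧
      ∀ w, ∑ u, f u w - ∑ u, f w u = (if w = b then 1 else 0) - (if w = a then 1 else 0) := by
  induction h with
  | @single b h =>
    refine ⟨fun u v => if u = a ∧ v = b then 1 else 0, ?_, ?_, ⟨a, b, by simp⟩, ?_⟩
    · intro u v; dsimp only; split_ifs <;> norm_num
    · intro u v huv
      simp only [ne_eq, ite_eq_right_iff, one_ne_zero, imp_false, not_not] at huv
      rw [huv.1, huv.2]; exact h
    · intro w
      simp only [ite_and, Finset.sum_ite_eq', Finset.mem_univ, if_true]
      congr 1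
      by_cases hw : w = a <;> simp [hw]
  | @tail b d _ h ih =>
    obtain ⟨f, h0, hD, ⟨p, q, hpq⟩, hf⟩ := ih
    refine ⟨fun u v => f u v + if u = b ∧ v = d then 1 else 0, ?_, ?_, ⟨p, q, ?_⟩, ?_⟩
    · intro u v
      have := h0 u v
      dsimp only; split_ifs <;> linarith
    · intro u v huv
      by_cases hbd : u = b ∧ v = d
      · rw [hbd.1, hbd.2]; exact h
      · simp only [hbd, if_false, add_zero] at huv
        exact hD u v huv
    · dsimp only; split_ifs <;> linarith
    · intro w
      have h1 := hf w
      have h2 : ∑ u, (if w = b ∧ u = d then (1 : ℝ) else 0) = if w = b then 1 else 0 := by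
        by_cases hw : w = b <;> simp [hw]
      simp only [Finset.sum_add_distrib, h2]
      simp only [ite_and, Finset.sum_ite_eq', Finset.mem_univ, if_true]
      linarith

/-- Integral weights form an orientation. A directed cycle would carry a circulation; pushing a
small multiple of it backwards changes no inflow, as equal amounts enter and leave each vertex, but
makes a weight fractional, against `eq_zero_or_one_of_extreme`. -/
theorem exists_inDegrees_eq_of_extreme {x : V → ℝ}
    (hx : x ∈ (graphicalZonotope G).extremePoints ℝ) :
    ∃ D : AcyclicOrientation G, inDegrees D.1 = x := by
  classical
  obtain ⟨t, ht, rfl⟩ := mem_graphicalZonotope.1 hx.1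
  have h01 := eq_zero_or_one_of_extreme ht hx
  let D : Digraph V := ⟨fun u v => t u v = 1⟩
  have htD : t = arcIndicator D := by
    ext u v
    rcases h01 u v with h | h <;> simp [arcIndicator, D, h]
  have hD : IsOrientation G D := by
    refine ⟨fun u v => ?_, fun u v (huv : t u v = 1) (hvu : t v u = 1) => ?_⟩
    · constructor
      · intro h
        have := ht.add_eq_one h
        rcases h01 u v with h1 | h1
        · right; change t v u = 1; linarith
        · exact Or.inl h1
      · rintro (h | h) <;> by_contra hna
        · have h' : t u v = 1 := h
          rw [ht.eq_zero_of_not_adj hna] at h'; norm_num at h'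
        · have h' : t v u = 1 := h
          rw [ht.eq_zero_of_not_adj fun h => hna h.symm] at h'; norm_num at h'
    · have := ht.2 u v
      split_ifs at this <;> linarith
  refine ⟨⟨D, hD, fun a ha => ?_⟩, by rw [htD, inflow_arcIndicator]⟩
  obtain ⟨f, hf0, hfD, ⟨p, q, hpq⟩, hf⟩ := exists_flow_of_transGen ha
  have hle : ∀ u v, f u v ≤ ∑ u, ∑ v, f u v := fun u v =>
    (Finset.single_le_sum (fun v _ => hf0 u v) (Finset.mem_univ v)).trans
      (Finset.single_le_sum (f := fun u => ∑ v, f u v)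
        (fun u _ => Finset.sum_nonneg fun v _ => hf0 u v) (Finset.mem_univ u))
  -- Scaling the flow by `1 / (2 * M)` bounds its entries by 1/2: the new weights stay nonnegative,
  -- and the weight of `p q` drops from 1 into [1/2, 1).
  set M := ∑ u, ∑ v, f u v with hM
  have hMpos : 0 < M := hpq.trans_le (hle p q)
  have hfrac : ∀ u v, f u v / (2 * M) ≤ 1 / 2 := by
    intro u v
    rw [div_le_div_iff₀ (by positivity) (by norm_num)]
    linarith [hle u v]
  have hfrac0 : ∀ u v, 0 ≤ f u v / (2 * M) := fun u v => div_nonneg (hf0 u v) (by positivity)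
  let t' : V → V → ℝ := fun u v => t u v - f u v / (2 * M) + f v u / (2 * M)
  have ht' : IsFractionalOrientation G t' := by
    refine ⟨fun u v => ?_, fun u v => ?_⟩
    · by_cases h : f u v = 0
      · simp only [t', h, zero_div, sub_zero]
        linarith [ht.1 u v, hfrac0 v u]
      · have h1 : t u v = 1 := hfD u v h
        simp only [t', h1]
        linarith [hfrac u v, hfrac0 v u]
    · rw [← ht.2 u v]
      simp only [t']; ring
  have hin : inflow t' = inflow t := by
    ext w
    have := hf w
    simp only [inflow, t', Finset.sum_add_distrib, Finset.sum_sub_distrib, ← Finset.sum_div]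
    rw [sub_self, sub_eq_zero] at this
    rw [this]; ring
  rw [← hin] at hx
  have hqp : f q p = 0 := by
    by_contra h
    exact hD.2 p q (hfD p q hpq.ne') (hfD q p h)
  have h1 : t p q = 1 := hfD p q hpq.ne'
  have h2 : 0 < f p q / (2 * M) := by positivity
  have h3 := hfrac p q
  rcases eq_zero_or_one_of_extreme ht' hx p q with h | h <;>
    simp only [t', hqp, h1, zero_div] at h <;> linarith

/-! ### Edges of the zonotope and arc flips -/

/-- Two acyclic orientations that differ in one arc admit a common labelling that is constant
on this arc and increases along all other arcs. -/
theorem exists_increasing_of_flip {a b : V} (hab : D.Adj a b) (hac : IsAcyclicDigraph D)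
    (hac' : IsAcyclicDigraph (reverseArc D a b)) :
    ∃ c : V → ℝ, c a = c b ∧ ∀ u v, D.Adj u v → ¬ (u = a ∧ v = b) → c u < c v := by
  obtain ⟨c, hc⟩ := hac.exists_increasing
  obtain ⟨c', hc'⟩ := hac'.exists_increasing
  have h1 := hc a b hab
  have h2 := hc' b a (Or.inl ⟨rfl, rfl⟩)
  -- A positive combination of increasing labellings of the two digraphs, with coefficients chosen
  -- to tie at `a` and `b`.
  refine ⟨fun v => (c' a - c' b) * c v + (c b - c a) * c' v, by ring, fun u v huv hne => ?_⟩
  have h3 := mul_lt_mul_of_pos_left (hc u v huv) (sub_pos.2 h2)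
  have h4 := mul_lt_mul_of_pos_left (hc' u v (Or.inr ⟨huv, hne⟩)) (sub_pos.2 h1)
  linarith

/-- The labelling of `exists_increasing_of_flip` fixes all weights except the split of the edge
`ab`, which parametrizes the segment. -/
theorem isExposed_segment_of_flip (hD : IsOrientation G D) (hac : IsAcyclicDigraph D)
    (hD' : IsOrientation G D') (hac' : IsAcyclicDigraph D') (h : IsArcFlip D D') :
    IsExposed ℝ (graphicalZonotope G) (segment ℝ (inDegrees D) (inDegrees D')) := by
  obtain ⟨a, b, hab, rfl⟩ := h
  obtain ⟨c, hcab, hc⟩ := exists_increasing_of_flip hab hac hac'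
  have hle : ∀ u v, D.Adj u v → c u ≤ c v := by
    intro u v huv
    by_cases h : u = a ∧ v = b
    · rw [h.1, h.2, hcab]
    · exact (hc u v huv h).le
  have hba : ¬ D.Adj b a := hD.2 a b hab
  refine isExposed_of_eq_face c ?_
  rw [face_graphicalZonotope hD hle]
  have hmix : ∀ r s : ℝ, r • inDegrees D + s • inDegrees (reverseArc D a b) =
      inflow (fun u v => r * arcIndicator D u v + s * arcIndicator (reverseArc D a b) u v) := by
    intro r s
    rw [← inflow_arcIndicator, ← inflow_arcIndicator]
    ext w
    simp only [inflow, Pi.add_apply, Pi.smul_apply, smul_eq_mul, Finset.sum_add_distrib,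
      Finset.mul_sum]
  have hrest : ∀ u v, D.Adj u v → ¬ (u = a ∧ v = b) → (reverseArc D a b).Adj u v :=
    fun u v huv hne => Or.inr ⟨huv, hne⟩
  ext x
  constructor
  · rintro ⟨t, ht, h1, rfl⟩
    have h1' : ∀ u v, D.Adj u v → ¬ (u = a ∧ v = b) → t u v = 1 :=
      fun u v huv hne => h1 u v huv (hc u v huv hne)
    have hsum := ht.add_eq_one ((hD.1 a b).2 (Or.inl hab))
    refine ⟨t a b, t b a, ht.1 a b, ht.1 b a, hsum, ?_⟩
    rw [hmix]
    congr 1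
    have hflip : ¬ (reverseArc D a b).Adj a b := hD'.2 b a (Or.inl ⟨rfl, rfl⟩)
    have hflip' : (reverseArc D a b).Adj b a := Or.inl ⟨rfl, rfl⟩
    have harc : ∀ u v, D.Adj u v → t u v = t a b * arcIndicator D u v +
        t b a * arcIndicator (reverseArc D a b) u v ∧ t v u = t a b * arcIndicator D v u +
        t b a * arcIndicator (reverseArc D a b) v u := by
      intro u v huv
      by_cases hne : u = a ∧ v = b
      · obtain ⟨rfl, rfl⟩ := hne
        simp [arcIndicator, hab, hba, hflip, hflip']
      · have h2 := hrest u v huv hne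
        have h3 := hD'.2 u v h2
        have h4 := hD.2 u v huv
        have h5 := ht.add_eq_one ((hD.1 u v).2 (Or.inl huv))
        have h6 := h1' u v huv hne
        have h7 : t v u = 0 := by linarith
        simp [arcIndicator, huv, h2, h3, h4, h6, hsum, h7]
    ext u v
    by_cases huv : D.Adj u v
    · exact (harc u v huv).1.symm
    · by_cases hvu : D.Adj v u
      · exact (harc v u hvu).2.symm
      · have h2 : ¬ G.Adj u v := by rw [hD.1]; tauto
        have h3 : ¬ (reverseArc D a b).Adj u v := fun h => h2 ((hD'.1 u v).2 (Or.inl h))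
        simp [arcIndicator, huv, h3, ht.eq_zero_of_not_adj h2]
  · rintro ⟨r, s, hr, hs, hrs, rfl⟩
    have ht := hD.isFractionalOrientation
    have ht' := hD'.isFractionalOrientation
    refine ⟨_, ⟨fun u v => ?_, fun u v => ?_⟩, fun u v huv hlt => ?_, (hmix r s).symm⟩
    · exact add_nonneg (mul_nonneg hr (ht.1 u v)) (mul_nonneg hs (ht'.1 u v))
    · have h1 := ht.2 u v
      rw [← h1]
      have h2 := ht'.2 u v
      rw [← h1] at h2
      linear_combination s * h2 + (arcIndicator D u v + arcIndicator D v u) * hrs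
    · have hne : ¬ (u = a ∧ v = b) := by
        rintro ⟨rfl, rfl⟩
        exact hlt.ne hcab
      simp [arcIndicator, huv, hrest u v huv hne, hrs]

/-- If the segment between two vertices is an edge of the zonotope, then the difference of the
vertices is parallel to every edge of `G` in which the orientations differ. -/
theorem exists_smul_of_isExposed_segment [DecidableEq V] (hD : IsOrientation G D)
    (hD' : IsOrientation G D')
    (h : IsExposed ℝ (graphicalZonotope G) (segment ℝ (inDegrees D) (inDegrees D')))
    {u v : V} (huv : D.Adj u v) (hvu : D'.Adj v u) :
    ∃ θ : ℝ, (1 / 2 : ℝ) • (Pi.single u 1 - Pi.single v 1 : V → ℝ) =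
      θ • (inDegrees D' - inDegrees D) := by
  obtain ⟨l, hl⟩ := h ⟨_, left_mem_segment ℝ _ _⟩
  have hmem : ∀ s : ℝ, 0 ≤ s → s ≤ 1 →
      inDegrees D + s • (Pi.single u 1 - Pi.single v 1) ∈ graphicalZonotope G := by
    intro s hs hs1
    have := inflow_add_single_mem hD.isFractionalOrientation (u := u) (v := v) hs
      (by rw [arcIndicator_eq_one.2 huv]; exact hs1)
    rw [inflow_arcIndicator] at this
    convert this
  have hmem' : inDegrees D' + (1 : ℝ) • (Pi.single v 1 - Pi.single u 1) ∈
      graphicalZonotope G := by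
    have := inflow_add_single_mem hD'.isFractionalOrientation (u := v) (v := u) (s := 1)
      zero_le_one (arcIndicator_eq_one.2 hvu).ge
    rw [inflow_arcIndicator] at this
    convert this
  have hDmax : inDegrees D ∈ {x ∈ graphicalZonotope G | ∀ y ∈ graphicalZonotope G, l y ≤ l x} :=
    hl ▸ left_mem_segment ℝ _ _
  have hDmax' : inDegrees D' ∈
      {x ∈ graphicalZonotope G | ∀ y ∈ graphicalZonotope G, l y ≤ l x} :=
    hl ▸ right_mem_segment ℝ _ _
  -- Both endpoints are maximal for `l`. Reversing the edge at `D` and at `D'` yields opposite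
  -- inequalities, so `l` agrees on its two unit vectors and half a reversal stays in the face.
  have h1 := hDmax.2 _ (hmem 1 zero_le_one le_rfl)
  have h2 := hDmax'.2 _ hmem'
  simp only [map_add, map_smul, map_sub, smul_eq_mul, one_mul] at h1 h2
  have heq : l (Pi.single u 1) = l (Pi.single v 1) := by linarith
  have h3 : inDegrees D + (1 / 2 : ℝ) • (Pi.single u 1 - Pi.single v 1) ∈
      segment ℝ (inDegrees D) (inDegrees D') := by
    rw [hl]
    refine ⟨hmem _ (by norm_num) (by norm_num), fun y hy => ?_⟩
    simpa [heq] using hDmax.2 y hy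
  rw [segment_eq_image'] at h3
  obtain ⟨θ, -, hθ⟩ := h3
  exact ⟨θ, (add_left_cancel hθ).symm⟩

/-- Any two arcs in which the orientations differ give vectors `e_u - e_v` parallel to the same
segment, and such vectors are parallel only for the same edge. -/
theorem isArcFlip_of_isExposed_segment (hD : IsOrientation G D) (hD' : IsOrientation G D')
    (hne : D ≠ D')
    (h : IsExposed ℝ (graphicalZonotope G) (segment ℝ (inDegrees D) (inDegrees D'))) :
    IsArcFlip D D' := by
  classical
  have hdiff : ∀ u v, D.Adj u v → ¬ D'.Adj u v → D'.Adj v u := fun u v huv hn =>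
    ((hD'.1 u v).1 ((hD.1 u v).2 (Or.inl huv))).resolve_left hn
  obtain ⟨a, b, hab, hab'⟩ : ∃ a b, D.Adj a b ∧ ¬ D'.Adj a b := by
    by_contra! hcon
    exact hne (hD.eq_of_le hD' hcon)
  have hba := hdiff a b hab hab'
  obtain ⟨θ, hθ⟩ := exists_smul_of_isExposed_segment hD hD' h hab hba
  have hneab : a ≠ b := ((hD.1 a b).2 (Or.inl hab)).ne
  have honly : ∀ u v, D.Adj u v → ¬ D'.Adj u v → u = a ∧ v = b := by
    intro u v huv huv'
    have hvu := hdiff u v huv huv'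
    have hneuv : u ≠ v := ((hD.1 u v).2 (Or.inl huv)).ne
    obtain ⟨η, hη⟩ := exists_smul_of_isExposed_segment hD hD' h huv hvu
    have hθ0 : θ ≠ 0 := by
      rintro rfl
      have := congrFun hθ a
      simp [hneab] at this
    have hη0 : η ≠ 0 := by
      rintro rfl
      have := congrFun hη u
      simp [hneuv] at this
    have hpar : ∀ w, η * ((Pi.single a 1 : V → ℝ) w - (Pi.single b 1 : V → ℝ) w) =
        θ * ((Pi.single u 1 : V → ℝ) w - (Pi.single v 1 : V → ℝ) w) := by
      intro w
      have h1 := congrFun hθ w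
      have h2 := congrFun hη w
      simp only [Pi.smul_apply, Pi.sub_apply, smul_eq_mul] at h1 h2
      linear_combination 2 * η * h1 - 2 * θ * h2
    have ha := hpar a
    have hb := hpar b
    have hcase : (a = u ∧ b = v) ∨ (a = v ∧ b = u) := by
      simp only [Pi.single_apply, hneab, hneab.symm, if_true, if_false] at ha hb
      by_cases h1 : a = u
      · left
        refine ⟨h1, ?_⟩
        by_contra h2
        have h3 : b ≠ u := fun h => hneab (h1.trans h.symm)
        simp [h2, h3, hη0] at hb
      · by_cases h2 : a = v
        · right
          refine ⟨h2, ?_⟩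
          by_contra h3
          have h4 : b ≠ v := fun h => hneab (h2.trans h.symm)
          simp [h3, h4, hη0] at hb
        · simp [h1, h2, hη0] at ha
    rcases hcase with ⟨rfl, rfl⟩ | ⟨rfl, rfl⟩
    · exact ⟨rfl, rfl⟩
    · exact absurd huv (hD.2 a b hab)
  refine ⟨a, b, hab, ?_⟩
  ext x y
  constructor
  · intro hxy
    by_cases hxy0 : D.Adj x y
    · refine Or.inr ⟨hxy0, ?_⟩
      rintro ⟨rfl, rfl⟩
      exact hab' hxy
    · have hyx : D.Adj y x := ((hD.1 x y).1 ((hD'.1 x y).2 (Or.inl hxy))).resolve_left hxy0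
      have := honly y x hyx (hD'.2 x y hxy)
      exact Or.inl ⟨this.2, this.1⟩
  · rintro (⟨rfl, rfl⟩ | ⟨hxy, hn⟩)
    · exact hba
    · by_contra hc
      exact hn (honly x y hxy hc)

/-- The flip graph is the skeleton of the graphical zonotope. -/
theorem exists_flipGraph_iso_skeleton (G : SimpleGraph V) :
    ∃ φ : flipGraph G ≃g skeleton (graphicalZonotope G),
      ∀ D : AcyclicOrientation G, (φ D : V → ℝ) = inDegrees D.1 := by
  let f : AcyclicOrientation G → (graphicalZonotope G).extremePoints ℝ :=
    fun D => ⟨inDegrees D.1, inDegrees_mem_extremePoints D.2.1 D.2.2⟩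
  have hf : Function.Bijective f := by
    constructor
    · intro D D' h
      exact Subtype.ext (inDegrees_injective D.2.1 D.2.2 D'.2.1 (congrArg Subtype.val h))
    · rintro ⟨x, hx⟩
      obtain ⟨D, hD⟩ := exists_inDegrees_eq_of_extreme hx
      exact ⟨D, Subtype.ext hD⟩
  refine ⟨⟨Equiv.ofBijective f hf, ?_⟩, fun D => rfl⟩
  intro D D'
  change (f D ≠ f D' ∧ IsExposed ℝ (graphicalZonotope G)
    (segment ℝ (inDegrees D.1) (inDegrees D'.1))) ↔ IsArcFlip D.1 D'.1
  constructor
  · rintro ⟨hne, h⟩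
    exact isArcFlip_of_isExposed_segment D.2.1 D'.2.1
      (fun h => hne (congrArg f (Subtype.ext h))) h
  · intro h
    refine ⟨fun he => ?_, isExposed_segment_of_flip D.2.1 D.2.2 D'.2.1 D'.2.2 h⟩
    exact h.ne_of_isOrientation D.2.1 (congrArg Subtype.val (hf.1 he))

end Zonotope

/-! ### Inserting the largest value -/

section InsertLargest

variable {n : ℕ}

theorem insertLargest_eq {π : List (Fin n)} {k : ℕ} (hk : k ≤ π.length) :
    insertLargest π k =
      (π.take k).map Fin.castSucc ++ Fin.last n :: (π.drop k).map Fin.castSucc := by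
  unfold insertLargest
  induction π generalizing k with
  | nil => obtain rfl : k = 0 := by simpa using hk
           simp
  | cons a π ih =>
    cases k with
    | zero => simp
    | succ k => simpa using ih (by simpa using hk)

theorem last_notMem_map_castSucc (π : List (Fin n)) : Fin.last n ∉ π.map Fin.castSucc := by
  simp [Fin.castSucc_ne_last]

theorem idxOf_map_castSucc (π : List (Fin n)) (v : Fin n) :
    (π.map Fin.castSucc).idxOf v.castSucc = π.idxOf v := by
  induction π with
  | nil => rfl
  | cons a π ih =>
    by_cases h : a = v
    · simp [h]
    · rw [List.map_cons, List.idxOf_cons_ne _ (by simpa using h), List.idxOf_cons_ne _ h, ih]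

theorem idxOf_last_insertLargest {π : List (Fin n)} {k : ℕ} (hk : k ≤ π.length) :
    (insertLargest π k).idxOf (Fin.last n) = k := by
  rw [insertLargest_eq hk, List.idxOf_append_of_notMem (last_notMem_map_castSucc _)]
  simpa using hk

theorem idxOf_castSucc_insertLargest {π : List (Fin n)} {k : ℕ} (hk : k ≤ π.length)
    {v : Fin n} (hv : v ∈ π) : (insertLargest π k).idxOf v.castSucc =
      if π.idxOf v < k then π.idxOf v else π.idxOf v + 1 := by
  rw [insertLargest_eq hk]
  have hmem := List.mem_take_iff_idxOf_lt (n := k) hv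
  conv_rhs => rw [← List.take_append_drop k π]
  split_ifs with h
  · rw [List.take_append_drop] at h
    rw [List.idxOf_append_of_mem (List.mem_map_of_mem (hmem.2 h)), idxOf_map_castSucc,
      List.idxOf_append_of_mem (hmem.2 h)]
  · rw [List.take_append_drop] at h
    rw [List.idxOf_append_of_notMem (fun h' => h (hmem.1
        ((List.mem_map_of_injective (Fin.castSucc_injective n)).1 h'))),
      List.idxOf_append_of_notMem (fun h' => h (hmem.1 h')),
      List.idxOf_cons_ne _ (Fin.castSucc_ne_last v).symm, idxOf_map_castSucc]
    simp
    omega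

theorem insertLargest_injective {π ρ : List (Fin n)} {k l : ℕ} (hk : k ≤ π.length)
    (hl : l ≤ ρ.length) (h : insertLargest π k = insertLargest ρ l) : π = ρ ∧ k = l := by
  have hkl : k = l := by
    rw [← idxOf_last_insertLargest hk, h, idxOf_last_insertLargest hl]
  subst hkl
  refine ⟨List.map_injective_iff.2 (Fin.castSucc_injective n) ?_, rfl⟩
  have := congrArg (fun x => List.eraseIdx x k) h
  simpa [insertLargest, List.eraseIdx_insertIdx_self] using this

theorem insertLargest_zero (π : List (Fin n)) :
    insertLargest π 0 = Fin.last n :: π.map Fin.castSucc := by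
  simp [insertLargest]

theorem insertLargest_length {π : List (Fin n)} {k : ℕ} (hk : k = π.length) :
    insertLargest π k = π.map Fin.castSucc ++ [Fin.last n] := by
  rw [insertLargest_eq hk.le]
  simp [hk]

end InsertLargest

theorem length_encode {n : ℕ} (D : Digraph (Fin n)) : (encode D).length = n := by
  simpa using (encode_perm D).length_eq

theorem mem_encode {n : ℕ} (D : Digraph (Fin n)) (v : Fin n) : v ∈ encode D :=
  (encode_perm D).mem_iff.2 (List.mem_finRange v)

theorem nodup_encode {n : ℕ} (D : Digraph (Fin n)) : (encode D).Nodup :=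
  (encode_perm D).nodup_iff.2 (List.nodup_finRange n)

theorem idxOf_encode_lt {n : ℕ} (D : Digraph (Fin n)) (v : Fin n) : (encode D).idxOf v < n := by
  simpa [length_encode] using List.idxOf_lt_length_of_mem (mem_encode D v)

theorem idxOf_encode_inj {n : ℕ} {D : Digraph (Fin n)} {u v : Fin n}
    (h : (encode D).idxOf u = (encode D).idxOf v) : u = v :=
  (List.idxOf_inj (mem_encode D u)).1 h

/-! ### Extending an acyclic orientation to the largest vertex -/

section Extension

variable {n : ℕ}

/-- The subgraph induced by all vertices except the last one. -/
abbrev deleteLastGraph (G : SimpleGraph (Fin (n + 1))) : SimpleGraph (Fin n) :=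
  G.comap Fin.castSucc

theorem IsPerfectEliminationOrder.adj_of_adj_last {G : SimpleGraph (Fin (n + 1))}
    (hG : IsPerfectEliminationOrder G) {u v : Fin n} (hu : G.Adj (Fin.last n) u.castSucc)
    (hv : G.Adj (Fin.last n) v.castSucc) (huv : u ≠ v) : G.Adj u.castSucc v.castSucc := by
  have := hG (Fin.last n) (x := ⟨u.castSucc, Fin.le_last _⟩) hu (y := ⟨v.castSucc, Fin.le_last _⟩)
    hv fun h => huv (Fin.castSucc_injective n (congrArg Subtype.val h))
  exact this

theorem IsPerfectEliminationOrder.deleteLast {G : SimpleGraph (Fin (n + 1))}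
    (hG : IsPerfectEliminationOrder G) : IsPerfectEliminationOrder (deleteLastGraph G) := by
  rintro i ⟨a, ha⟩ hia ⟨b, hb⟩ hib hab
  exact hG i.castSucc (x := ⟨a.castSucc, ha⟩) hia (y := ⟨b.castSucc, hb⟩) hib
    fun h => hab (Subtype.ext (Fin.castSucc_injective _ (congrArg Subtype.val h)))

theorem isAcyclicDigraph_of_increasing {V : Type*} {D : Digraph V} (f : V → ℕ)
    (hf : ∀ u v, D.Adj u v → f u < f v) : IsAcyclicDigraph D := by
  have key : ∀ u v, Relation.TransGen D.Adj u v → f u < f v := by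
    intro u v h
    induction h with
    | single h => exact hf _ _ h
    | tail _ h ih => exact ih.trans (hf _ _ h)
  exact fun v hv => (key v v hv).false

/-- Every arc of `D` points from left to right in `π`. -/
def IsTopologicalOrder (D : Digraph (Fin n)) (π : List (Fin n)) : Prop :=
  ∀ u v, D.Adj u v → π.idxOf u < π.idxOf v

/-- Orient the edges at the last vertex as if it were inserted into `π` at position `p`. -/
def extendLast (G : SimpleGraph (Fin (n + 1))) (D : Digraph (Fin n)) (π : List (Fin n)) (p : ℕ) :
    Digraph (Fin (n + 1)) where
  Adj x y := (∃ u v, D.Adj u v ∧ x = u.castSucc ∧ y = v.castSucc) ∨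
    (∃ v, (G.Adj (Fin.last n) v.castSucc ∧ p ≤ π.idxOf v) ∧ x = Fin.last n ∧ y = v.castSucc) ∨
    (∃ u, (G.Adj (Fin.last n) u.castSucc ∧ π.idxOf u < p) ∧ x = u.castSucc ∧ y = Fin.last n)

variable {G : SimpleGraph (Fin (n + 1))} {D : Digraph (Fin n)} {π : List (Fin n)} {p q : ℕ}

@[simp]
theorem extendLast_castSucc_castSucc {u v : Fin n} :
    (extendLast G D π p).Adj u.castSucc v.castSucc ↔ D.Adj u v := by
  simp [extendLast, Fin.castSucc_ne_last]

@[simp]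
theorem extendLast_last_castSucc {v : Fin n} : (extendLast G D π p).Adj (Fin.last n) v.castSucc ↔
    G.Adj (Fin.last n) v.castSucc ∧ p ≤ π.idxOf v := by
  simp [extendLast, Fin.castSucc_ne_last, (Fin.castSucc_ne_last _).symm]

@[simp]
theorem extendLast_castSucc_last {u : Fin n} : (extendLast G D π p).Adj u.castSucc (Fin.last n) ↔
    G.Adj (Fin.last n) u.castSucc ∧ π.idxOf u < p := by
  simp [extendLast, Fin.castSucc_ne_last, (Fin.castSucc_ne_last _).symm]

@[simp]
theorem extendLast_last_last : ¬ (extendLast G D π p).Adj (Fin.last n) (Fin.last n) := by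
  simp [extendLast, (Fin.castSucc_ne_last _).symm]

@[simp]
theorem deleteLast_extendLast : deleteLast (extendLast G D π p) = D := by
  ext u v
  simp [deleteLast]

theorem isOrientation_extendLast (hD : IsOrientation (deleteLastGraph G) D) :
    IsOrientation G (extendLast G D π p) := by
  constructor
  · intro u v
    induction u using Fin.lastCases with
    | last =>
      induction v using Fin.lastCases with
      | last => simp
      | cast v =>
        simp only [extendLast_last_castSucc, extendLast_castSucc_last, ← and_or_left, le_or_gt,
          and_true]
    | cast u =>
      induction v using Fin.lastCases with
      | last =>
        simp only [extendLast_last_castSucc, extendLast_castSucc_last, ← and_or_left, lt_or_ge,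
          and_true, G.adj_comm]
      | cast v => simpa using hD.1 u v
  · intro u v
    induction u using Fin.lastCases with
    | last =>
      induction v using Fin.lastCases with
      | last => simp
      | cast v => simp; omega
    | cast u =>
      induction v using Fin.lastCases with
      | last => simp; omega
      | cast v => simpa using hD.2 u v

/-- A labelling that increases along the arcs of `extendLast G D π p`. -/
def extendLabel (π : List (Fin n)) (p : ℕ) : Fin (n + 1) → ℕ :=
  -- Entries receive odd labels, so that `2 * p` falls strictly between positions `p - 1` and `p`.
  Fin.lastCases (2 * p) fun v => 2 * π.idxOf v + 1

theorem extendLabel_lt (hπ : IsTopologicalOrder D π) {u v : Fin (n + 1)}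
    (h : (extendLast G D π p).Adj u v) : extendLabel π p u < extendLabel π p v := by
  induction u using Fin.lastCases with
  | last =>
    induction v using Fin.lastCases with
    | last => simp at h
    | cast v =>
      have := (extendLast_last_castSucc.1 h).2
      simp [extendLabel]; omega
  | cast u =>
    induction v using Fin.lastCases with
    | last =>
      have := (extendLast_castSucc_last.1 h).2
      simp [extendLabel]; omega
    | cast v =>
      have := hπ u v (by simpa using h)
      simp [extendLabel]; omega

theorem extendLabel_lt_of_transGen (hπ : IsTopologicalOrder D π) {u v : Fin (n + 1)}
    (h : Relation.TransGen (extendLast G D π p).Adj u v) :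
    extendLabel π p u < extendLabel π p v := by
  induction h with
  | single h => exact extendLabel_lt hπ h
  | tail _ h ih => exact ih.trans (extendLabel_lt hπ h)

/-! ### Slots for the last vertex -/

open Classical in
/-- The positions at which the last vertex is inserted into `π` by the encoding. -/
noncomputable def slots (G : SimpleGraph (Fin (n + 1))) (π : List (Fin n)) : Finset ℕ :=
  (Finset.range (n + 1)).filter fun p => p = n ∨
    (p = 0 ∧ ∃ v : Fin n, G.Adj (Fin.last n) v.castSucc) ∨
    ∃ v u : Fin n, G.Adj (Fin.last n) v.castSucc ∧ G.Adj (Fin.last n) u.castSucc ∧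
      π.idxOf v = p ∧ π.idxOf u < p

/-- The alternatives correspond to a sink, a source, and a place directly before a neighbor other
than the leftmost one; directly before the leftmost neighbor, the last vertex would again be a
source, which position 0 already covers. -/
theorem mem_slots : p ∈ slots G π ↔ p ≤ n ∧ (p = n ∨
    (p = 0 ∧ ∃ v : Fin n, G.Adj (Fin.last n) v.castSucc) ∨
    ∃ v u : Fin n, G.Adj (Fin.last n) v.castSucc ∧ G.Adj (Fin.last n) u.castSucc ∧
      π.idxOf v = p ∧ π.idxOf u < p) := by
  simp [slots]

/-- Here `v` is the leftmost out-neighbor. Every other out-neighbor is adjacent to `v` and stands to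
its right, so it is reached through `v`. -/
theorem transitiveReduction_extendLast_iff (hG : IsPerfectEliminationOrder G)
    (hD : IsOrientation (deleteLastGraph G) D) (hπ : IsTopologicalOrder D π) {v : Fin n}
    (hv : G.Adj (Fin.last n) v.castSucc) (x : Fin (n + 1)) :
    (transitiveReduction (extendLast G D π (π.idxOf v))).Adj (Fin.last n) x ↔ x = v.castSucc := by
  constructor
  · rintro ⟨h1, h2⟩
    induction x using Fin.lastCases with
    | last => simp at h1
    | cast x =>
      by_contra hne
      have hne' : v ≠ x := fun h => hne (by rw [h])
      rw [extendLast_last_castSucc] at h1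
      have hadj : (deleteLastGraph G).Adj v x := hG.adj_of_adj_last hv h1.1 hne'
      rcases (hD.1 v x).1 hadj with h | h
      · exact h2 ⟨v.castSucc, .single (by simp [hv]), .single (by simpa using h)⟩
      · have := hπ _ _ h
        omega
  · rintro rfl
    refine ⟨by simp [hv], ?_⟩
    rintro ⟨w, h1, h2⟩
    have h3 := extendLabel_lt_of_transGen hπ h1
    have h4 := extendLabel_lt_of_transGen hπ h2
    simp [extendLabel] at h3 h4
    omega

theorem encode_extendLast (hG : IsPerfectEliminationOrder G)
    (hD : IsOrientation (deleteLastGraph G) D) (hπ : IsTopologicalOrder D (encode D))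
    (hp : p ∈ slots G (encode D)) :
    encode (extendLast G D (encode D) p) = insertLargest (encode D) p := by
  rw [encode]
  simp only [deleteLast_extendLast]
  obtain ⟨hpn, hp⟩ := mem_slots.1 hp
  split_ifs with h1 h2
  · congr 1
    have h1' : ∀ v : Fin n, G.Adj (Fin.last n) v.castSucc → (encode D).idxOf v < p := by
      intro v hv
      by_contra hlt
      exact h1 v.castSucc (by simpa [hv] using hlt)
    rcases hp with rfl | ⟨rfl, v, hv⟩ | ⟨v, u, hv, -, rfl, -⟩
    · rfl
    · exact absurd (h1' v hv) (by omega)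
    · exact absurd (h1' v hv) (by omega)
  · push Not at h1
    obtain ⟨x, hx⟩ := h1
    congr 1
    rcases hp with rfl | ⟨rfl, -⟩ | ⟨v, u, -, hu, rfl, hlt⟩
    · induction x using Fin.lastCases with
      | last => simp at hx
      | cast x =>
        have := (extendLast_last_castSucc.1 hx).2
        have := idxOf_encode_lt D x
        omega
    · rfl
    · exact absurd (extendLast_castSucc_last.2 ⟨hu, hlt⟩) (h2 u.castSucc)
  · push Not at h1 h2
    obtain ⟨x, hx⟩ := h1
    obtain ⟨y, hy⟩ := h2
    rcases hp with rfl | ⟨rfl, -⟩ | ⟨v, u, hv, hu, rfl, hlt⟩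
    · induction x using Fin.lastCases with
      | last => simp at hx
      | cast x =>
        have := (extendLast_last_castSucc.1 hx).2
        have := idxOf_encode_lt D x
        omega
    · induction y using Fin.lastCases with
      | last => simp at hy
      | cast y =>
        have := (extendLast_castSucc_last.1 hy).2
        omega
    · simp only [transitiveReduction_extendLast_iff hG hD hπ hv]
      have : (Classical.epsilon fun x => x = v.castSucc) = v.castSucc :=
        Classical.epsilon_singleton _
      rw [this, idxOf_map_castSucc]

theorem isOrientation_deleteLast {D : Digraph (Fin (n + 1))} (hD : IsOrientation G D) :
    IsOrientation (deleteLastGraph G) (deleteLast D) :=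
  ⟨fun u v => hD.1 u.castSucc v.castSucc, fun u v => hD.2 u.castSucc v.castSucc⟩

theorem isAcyclicDigraph_deleteLast {D : Digraph (Fin (n + 1))} (hD : IsAcyclicDigraph D) :
    IsAcyclicDigraph (deleteLast D) :=
  fun v hv => hD v.castSucc (hv.lift Fin.castSucc fun _ _ h => h)

theorem exists_extendLast_eq (hG : IsPerfectEliminationOrder G) {D : Digraph (Fin (n + 1))}
    (hD : IsOrientation G D) (hac : IsAcyclicDigraph D)
    (htop : IsTopologicalOrder (deleteLast D) (encode (deleteLast D))) :
    ∃ p ∈ slots G (encode (deleteLast D)),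
      D = extendLast G (deleteLast D) (encode (deleteLast D)) p := by
  set π := encode (deleteLast D) with hπ
  suffices h : ∃ p ∈ slots G π, (∀ v : Fin n, D.Adj (Fin.last n) v.castSucc → p ≤ π.idxOf v) ∧
      ∀ v : Fin n, D.Adj v.castSucc (Fin.last n) → π.idxOf v < p by
    obtain ⟨p, hp, hout, hin⟩ := h
    refine ⟨p, hp, hD.eq_of_le (isOrientation_extendLast (isOrientation_deleteLast hD)) ?_⟩
    intro u v huv
    have hadj := (hD.1 u v).2 (Or.inl huv)
    induction u using Fin.lastCases with
    | last =>
      induction v using Fin.lastCases with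
      | last => exact absurd huv (hD.2 _ _ huv)
      | cast v => exact extendLast_last_castSucc.2 ⟨hadj, hout v huv⟩
    | cast u =>
      induction v using Fin.lastCases with
      | last => exact extendLast_castSucc_last.2 ⟨hadj.symm, hin u huv⟩
      | cast v => exact extendLast_castSucc_castSucc.2 huv
  by_cases h1 : ∃ v : Fin n, D.Adj (Fin.last n) v.castSucc
  · by_cases h2 : ∃ u : Fin n, D.Adj u.castSucc (Fin.last n)
    · obtain ⟨v, hv, hmin⟩ := Set.exists_min_image {v : Fin n | D.Adj (Fin.last n) v.castSucc}
        (fun v => π.idxOf v) (Set.toFinite _) h1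
      -- The neighbors `u` and `v` are adjacent, and an arc from `v` to `u` would close a directed
      -- triangle with the last vertex.
      have hin : ∀ u : Fin n, D.Adj u.castSucc (Fin.last n) → π.idxOf u < π.idxOf v := by
        intro u hu
        have hu' := (hD.1 _ _).2 (Or.inr hu)
        have hv' := (hD.1 _ _).2 (Or.inl hv)
        have hne : u ≠ v := by
          rintro rfl
          exact hD.2 _ _ hu hv
        rcases (hD.1 _ _).1 (hG.adj_of_adj_last hu' hv' hne) with h | h
        · exact htop u v h
        · exact absurd (((Relation.TransGen.single hv).tail h).tail hu) (hac _)
      obtain ⟨u, hu⟩ := h2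
      refine ⟨π.idxOf v, mem_slots.2 ⟨(idxOf_encode_lt _ v).le, Or.inr (Or.inr ⟨v, u,
        (hD.1 _ _).2 (Or.inl hv), (hD.1 _ _).2 (Or.inr hu), rfl, hin u hu⟩)⟩, hmin, hin⟩
    · push Not at h2
      obtain ⟨v, hv⟩ := h1
      exact ⟨0, mem_slots.2 ⟨Nat.zero_le _, Or.inr (Or.inl ⟨rfl, v, (hD.1 _ _).2 (Or.inl hv)⟩)⟩,
        fun _ _ => Nat.zero_le _, fun u hu => absurd hu (h2 u)⟩
  · push Not at h1
    exact ⟨n, mem_slots.2 ⟨le_rfl, Or.inl rfl⟩, fun v hv => absurd hv (h1 v),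
      fun v _ => idxOf_encode_lt _ v⟩

/-- The encoding of an acyclic orientation is a topological order. -/
theorem isTopologicalOrder_encode : ∀ {n : ℕ} {G : SimpleGraph (Fin n)} {D : Digraph (Fin n)},
    IsPerfectEliminationOrder G → IsOrientation G D → IsAcyclicDigraph D →
    IsTopologicalOrder D (encode D)
  | 0, _, _, _, _, _ => fun u => u.elim0
  | n + 1, G, D, hG, hD, hac => by
    have ih := isTopologicalOrder_encode hG.deleteLast (isOrientation_deleteLast hD)
      (isAcyclicDigraph_deleteLast hac)
    obtain ⟨p, hp, hDp⟩ := exists_extendLast_eq hG hD hac ih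
    rw [hDp, encode_extendLast hG (isOrientation_deleteLast hD) ih hp]
    set D' := deleteLast D
    have hpn : p ≤ (encode D').length := by
      rw [length_encode]; exact (mem_slots.1 hp).1
    intro u v huv
    induction u using Fin.lastCases with
    | last =>
      induction v using Fin.lastCases with
      | last => simp at huv
      | cast v =>
        have := (extendLast_last_castSucc.1 huv).2
        rw [idxOf_last_insertLargest hpn, idxOf_castSucc_insertLargest hpn (mem_encode D' v)]
        split_ifs <;> omega
    | cast u =>
      induction v using Fin.lastCases with
      | last =>
        have := (extendLast_castSucc_last.1 huv).2
        rw [idxOf_last_insertLargest hpn, idxOf_castSucc_insertLargest hpn (mem_encode D' u)]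
        split_ifs; omega
      | cast v =>
        have := ih u v (extendLast_castSucc_castSucc.1 huv)
        rw [idxOf_castSucc_insertLargest hpn (mem_encode D' u),
          idxOf_castSucc_insertLargest hpn (mem_encode D' v)]
        split_ifs <;> omega

/-- The list is a topological order of both digraphs, so it dictates the direction of every edge. -/
theorem encode_injective {n : ℕ} {G : SimpleGraph (Fin n)} (hG : IsPerfectEliminationOrder G) :
    Function.Injective fun D : AcyclicOrientation G => encode D.1 := by
  intro D D' h
  refine Subtype.ext (D.2.1.eq_of_le D'.2.1 fun u v huv => ?_)
  have h1 := isTopologicalOrder_encode hG D.2.1 D.2.2 u v huv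
  refine ((D'.2.1.1 u v).1 ((D.2.1.1 u v).2 (Or.inl huv))).resolve_right fun hvu => ?_
  have h2 := isTopologicalOrder_encode hG D'.2.1 D'.2.2 v u hvu
  rw [show encode D.1 = encode D'.1 from h] at h1
  omega

/-- The acyclic orientation without the last vertex. -/
def AcyclicOrientation.deleteLast (D : AcyclicOrientation G) :
    AcyclicOrientation (deleteLastGraph G) :=
  ⟨AcyclicGray.deleteLast D.1, isOrientation_deleteLast D.2.1, isAcyclicDigraph_deleteLast D.2.2⟩

/-- The acyclic orientation that arises by inserting the last vertex at position `p`. -/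
noncomputable def AcyclicOrientation.extendLast (hG : IsPerfectEliminationOrder G)
    (D : AcyclicOrientation (deleteLastGraph G)) (p : ℕ) : AcyclicOrientation G :=
  ⟨AcyclicGray.extendLast G D.1 (encode D.1) p, isOrientation_extendLast D.2.1,
    isAcyclicDigraph_of_increasing (extendLabel (encode D.1) p) fun _ _ h =>
      extendLabel_lt (isTopologicalOrder_encode hG.deleteLast D.2.1 D.2.2) h⟩

theorem AcyclicOrientation.deleteLast_extendLast (hG : IsPerfectEliminationOrder G)
    (D : AcyclicOrientation (deleteLastGraph G)) (p : ℕ) : (D.extendLast hG p).deleteLast = D :=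
  Subtype.ext AcyclicGray.deleteLast_extendLast

theorem AcyclicOrientation.encode_extendLast (hG : IsPerfectEliminationOrder G)
    (D : AcyclicOrientation (deleteLastGraph G)) (hp : p ∈ slots G (encode D.1)) :
    encode (D.extendLast hG p).1 = insertLargest (encode D.1) p :=
  AcyclicGray.encode_extendLast hG D.2.1 (isTopologicalOrder_encode hG.deleteLast D.2.1 D.2.2) hp

theorem AcyclicOrientation.exists_extendLast_eq (hG : IsPerfectEliminationOrder G)
    (D : AcyclicOrientation G) :
    ∃ p ∈ slots G (encode D.deleteLast.1), D = D.deleteLast.extendLast hG p := by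
  obtain ⟨p, hp, h⟩ := AcyclicGray.exists_extendLast_eq hG D.2.1 D.2.2
    (isTopologicalOrder_encode hG.deleteLast D.deleteLast.2.1 D.deleteLast.2.2)
  exact ⟨p, hp, Subtype.ext h⟩

theorem exists_insertLargest_of_mem_encodings (hG : IsPerfectEliminationOrder G)
    {π : List (Fin (n + 1))} (hπ : π ∈ encodings G) :
    ∃ ρ ∈ encodings (deleteLastGraph G), ∃ p ∈ slots G ρ, π = insertLargest ρ p := by
  obtain ⟨D, rfl⟩ := hπ
  obtain ⟨p, hp, h⟩ := D.exists_extendLast_eq hG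
  refine ⟨_, ⟨D.deleteLast, rfl⟩, p, hp, ?_⟩
  conv_lhs => rw [h]
  exact AcyclicOrientation.encode_extendLast hG _ hp

theorem length_of_mem_encodings {n : ℕ} {G : SimpleGraph (Fin n)} {π : List (Fin n)}
    (hπ : π ∈ encodings G) : π.length = n := by
  obtain ⟨D, rfl⟩ := hπ
  exact length_encode _

theorem le_of_mem_slots (hp : p ∈ slots G π) : p ≤ n := (mem_slots.1 hp).1

/-- The recursive structure of the set of encodings, on which the analysis of Algorithm J rests. -/
theorem insertLargest_mem_encodings_iff (hG : IsPerfectEliminationOrder G)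
    (hπ : π.length = n) (hp : p ≤ n) :
    insertLargest π p ∈ encodings G ↔ π ∈ encodings (deleteLastGraph G) ∧ p ∈ slots G π := by
  constructor
  · intro h
    obtain ⟨ρ, hρ, q, hq, he⟩ := exists_insertLargest_of_mem_encodings hG h
    obtain ⟨rfl, rfl⟩ := insertLargest_injective (hp.trans hπ.ge)
      ((le_of_mem_slots hq).trans (length_of_mem_encodings hρ).ge) he
    exact ⟨hρ, hq⟩
  · rintro ⟨⟨D, rfl⟩, hp'⟩
    exact ⟨D.extendLast hG p, (AcyclicOrientation.encode_extendLast hG _ hp').symm⟩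

open Classical in
/-- The smallest slot, which does not depend on the permutation. -/
noncomputable def firstSlot (G : SimpleGraph (Fin (n + 1))) : ℕ :=
  if ∃ v : Fin n, G.Adj (Fin.last n) v.castSucc then 0 else n

theorem firstSlot_mem_slots : firstSlot G ∈ slots G π := by
  rw [mem_slots, firstSlot]
  split_ifs with h
  · exact ⟨Nat.zero_le _, Or.inr (Or.inl ⟨rfl, h⟩)⟩
  · exact ⟨le_rfl, Or.inl rfl⟩

theorem last_mem_slots : n ∈ slots G π := mem_slots.2 ⟨le_rfl, Or.inl rfl⟩

theorem firstSlot_le_of_mem_slots (hp : p ∈ slots G π) : firstSlot G ≤ p := by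
  rw [firstSlot]
  split_ifs with h
  · exact Nat.zero_le _
  · rcases (mem_slots.1 hp).2 with rfl | ⟨-, h'⟩ | ⟨v, -, hv, -⟩
    · exact le_rfl
    · exact absurd h' h
    · exact absurd ⟨v, hv⟩ h

theorem firstSlot_eq (G : SimpleGraph (Fin (n + 1))) : firstSlot G = 0 ∨ firstSlot G = n := by
  rw [firstSlot]
  split_ifs <;> simp

/-- Moving the last vertex to the next slot flips a single arc. -/
theorem isArcFlip_extendLast_of_lt (hp : p ∈ slots G (encode D)) (hq : q ∈ slots G (encode D))
    (hpq : p < q) (hbetween : ∀ r ∈ slots G (encode D), r ≤ p ∨ q ≤ r) :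
    IsArcFlip (extendLast G D (encode D) p) (extendLast G D (encode D) q) := by
  have hqn := le_of_mem_slots hq
  obtain ⟨v, hv, hpv, hvq⟩ : ∃ v : Fin n, G.Adj (Fin.last n) v.castSucc ∧
      p ≤ (encode D).idxOf v ∧ (encode D).idxOf v < q := by
    rcases (mem_slots.1 hp).2 with rfl | ⟨rfl, w, hw⟩ | ⟨v, -, hv, -, rfl, -⟩
    · omega
    · rcases (mem_slots.1 hq).2 with rfl | ⟨rfl, -⟩ | ⟨-, u, -, hu, -, hlt⟩
      · exact ⟨w, hw, Nat.zero_le _, idxOf_encode_lt D w⟩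
      · omega
      · exact ⟨u, hu, Nat.zero_le _, hlt⟩
    · exact ⟨v, hv, le_rfl, hpq⟩
  -- Of two neighbors at positions in `[p, q)`, the right one would mark a slot strictly between `p`
  -- and `q`.
  have huniq : ∀ w : Fin n, G.Adj (Fin.last n) w.castSucc → p ≤ (encode D).idxOf w →
      (encode D).idxOf w < q → w = v := by
    intro w hw hpw hwq
    by_contra hne
    rcases lt_trichotomy ((encode D).idxOf w) ((encode D).idxOf v) with h | h | h
    · have := hbetween _ (mem_slots.2 ⟨(idxOf_encode_lt D v).le,
        Or.inr (Or.inr ⟨v, w, hv, hw, rfl, h⟩)⟩)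
      omega
    · exact hne (idxOf_encode_inj h)
    · have := hbetween _ (mem_slots.2 ⟨(idxOf_encode_lt D w).le,
        Or.inr (Or.inr ⟨w, v, hw, hv, rfl, h⟩)⟩)
      omega
  refine ⟨Fin.last n, v.castSucc, extendLast_last_castSucc.2 ⟨hv, hpv⟩, ?_⟩
  ext x y
  induction x using Fin.lastCases with
  | last =>
    induction y using Fin.lastCases with
    | last => simp [reverseArc, (Fin.castSucc_ne_last _).symm]
    | cast y =>
      simp only [extendLast_last_castSucc, reverseArc, (Fin.castSucc_ne_last _).symm, false_and,
        false_or, true_and, Fin.castSucc_inj]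
      constructor
      · rintro ⟨h1, h2⟩
        refine ⟨⟨h1, by omega⟩, ?_⟩
        rintro rfl
        omega
      · rintro ⟨⟨h1, h2⟩, h3⟩
        refine ⟨h1, ?_⟩
        by_contra h4
        exact h3 (huniq y h1 h2 (by omega))
  | cast x =>
    induction y using Fin.lastCases with
    | last =>
      simp only [extendLast_castSucc_last, reverseArc, Fin.castSucc_ne_last, false_and, and_true,
        Fin.castSucc_inj, not_false_eq_true]
      constructor
      · rintro ⟨h1, h2⟩
        by_cases h3 : p ≤ (encode D).idxOf x
        · exact Or.inl (huniq x h1 h3 h2)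
        · exact Or.inr ⟨h1, by omega⟩
      · rintro (rfl | ⟨h1, h2⟩)
        · exact ⟨hv, hvq⟩
        · exact ⟨h1, by omega⟩
    | cast y => simp [reverseArc, Fin.castSucc_ne_last]

/-- Flips extend to the last vertex if this is made a source or a sink. -/
theorem IsArcFlip.extendLast {D D' : Digraph (Fin n)} (h : IsArcFlip D D')
    (hp : p = 0 ∨ p = n) :
    IsArcFlip (extendLast G D (encode D) p) (extendLast G D' (encode D') p) := by
  obtain ⟨a, b, hab, rfl⟩ := h
  refine ⟨a.castSucc, b.castSucc, extendLast_castSucc_castSucc.2 hab, ?_⟩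
  -- At an extreme position `p` the comparison is the same for all entries, so it does not matter
  -- that the two encodings differ.
  have hidx : ∀ v : Fin n, p ≤ (encode (reverseArc D a b)).idxOf v ↔ p ≤ (encode D).idxOf v := by
    intro v
    have h1 := idxOf_encode_lt (reverseArc D a b) v
    have h2 := idxOf_encode_lt D v
    omega
  generalize encode (reverseArc D a b) = π' at hidx ⊢
  ext x y
  induction x using Fin.lastCases with
  | last =>
    induction y using Fin.lastCases with
    | last => simp [reverseArc, (Fin.castSucc_ne_last _).symm]
    | cast y => simp [reverseArc, (Fin.castSucc_ne_last _).symm, hidx]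
  | cast x =>
    induction y using Fin.lastCases with
    | last =>
      simpa [reverseArc, (Fin.castSucc_ne_last _).symm] using fun _ =>
        lt_iff_lt_of_le_iff_le (hidx x)
    | cast y => simp [reverseArc]

end Extension

/-! ### Jumps -/

section Jump

variable {n : ℕ}

theorem insertLargest_append (A B : List (Fin n)) :
    insertLargest (A ++ B) A.length = A.map Fin.castSucc ++ Fin.last n :: B.map Fin.castSucc := by
  rw [insertLargest_eq (by simp)]
  simp

theorem eq_of_insertLargest_append {A B : List (Fin n)} {u v : List (Fin (n + 1))}
    (h : insertLargest (A ++ B) A.length = u ++ Fin.last n :: v) :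
    u = A.map Fin.castSucc ∧ v = B.map Fin.castSucc := by
  rw [insertLargest_append, List.append_cons_inj_of_notMem (last_notMem_map_castSucc _)
    (last_notMem_map_castSucc _)] at h
  exact ⟨h.1.symm, h.2.2.symm⟩

theorem exists_append_of_le {α : Type*} {l : List α} {k : ℕ} (hk : k ≤ l.length) :
    ∃ A B, l = A ++ B ∧ A.length = k :=
  ⟨l.take k, l.drop k, (List.take_append_drop k l).symm, by simpa using hk⟩

/-- The largest value may pass every entry, so its jumps are precisely the changes of insertion
position. -/
theorem isJump_right_last_iff {ρ : List (Fin n)} {p d : ℕ} (hp : p ≤ ρ.length)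
    {x : List (Fin (n + 1))} : IsJump .right (Fin.last n) d (insertLargest ρ p) x ↔
      0 < d ∧ p + d ≤ ρ.length ∧ x = insertLargest ρ (p + d) := by
  constructor
  · rintro ⟨u, s, v, rfl, hd, -, h, rfl⟩
    obtain ⟨A, B, rfl, rfl⟩ := exists_append_of_le hp
    obtain ⟨rfl, h2⟩ := eq_of_insertLargest_append (v := s ++ v) (by simpa using h)
    obtain ⟨S, T, rfl, rfl, rfl⟩ := List.map_eq_append_iff.1 h2.symm
    refine ⟨hd, by simp, ?_⟩
    have := insertLargest_append (A ++ S) T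
    simp only [List.append_assoc, List.length_append] at this
    simp [this]
  · rintro ⟨hd, hle, rfl⟩
    obtain ⟨A, B, rfl, rfl⟩ := exists_append_of_le hp
    obtain ⟨S, T, rfl, rfl⟩ := exists_append_of_le (l := B) (k := d) (by simpa using hle)
    refine ⟨A.map Fin.castSucc, S.map Fin.castSucc, T.map Fin.castSucc, by simp, hd,
      by simp [Fin.castSucc_lt_last], by simp [insertLargest_append], ?_⟩
    have := insertLargest_append (A ++ S) T
    simp only [List.append_assoc, List.length_append] at this
    simp [this]

theorem isJump_left_last_iff {ρ : List (Fin n)} {p d : ℕ} (hp : p ≤ ρ.length)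
    {x : List (Fin (n + 1))} : IsJump .left (Fin.last n) d (insertLargest ρ p) x ↔
      0 < d ∧ d ≤ p ∧ x = insertLargest ρ (p - d) := by
  constructor
  · rintro ⟨u, s, v, rfl, hd, -, h, rfl⟩
    obtain ⟨A, B, rfl, rfl⟩ := exists_append_of_le hp
    obtain ⟨h1, rfl⟩ := eq_of_insertLargest_append (u := u ++ s) (v := v) (by simpa using h)
    obtain ⟨S, T, rfl, rfl, rfl⟩ := List.map_eq_append_iff.1 h1.symm
    refine ⟨hd, by simp, ?_⟩
    have := insertLargest_append S (T ++ B)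
    simp [this]
  · rintro ⟨hd, hle, rfl⟩
    obtain ⟨A, B, rfl, rfl⟩ := exists_append_of_le hp
    obtain ⟨S, T, rfl, hS⟩ := exists_append_of_le (l := A) (k := A.length - d) (by omega)
    rw [← hS]
    simp only [List.length_append] at hS hle
    refine ⟨S.map Fin.castSucc, T.map Fin.castSucc, B.map Fin.castSucc, by simp; omega, hd,
      by simp [Fin.castSucc_lt_last], by simp only [insertLargest_append]; simp, ?_⟩
    rw [List.append_assoc, insertLargest_append]
    simp

/-- Two adjacent blocks without the largest value, which stands at one end, can be swapped before
or after deleting it. -/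
theorem exists_swap_of_insertLargest {π : List (Fin n)} {k : ℕ} (hk : k = 0 ∨ k = π.length)
    {u y z v : List (Fin (n + 1))} (h : insertLargest π k = u ++ y ++ z ++ v) (hne : y ++ z ≠ [])
    (hy : Fin.last n ∉ y ++ z) :
    ∃ u' y' z' v' : List (Fin n), π = u' ++ y' ++ z' ++ v' ∧ y = y'.map Fin.castSucc ∧
      z = z'.map Fin.castSucc ∧ u ++ z ++ y ++ v = insertLargest (u' ++ z' ++ y' ++ v') k := by
  rcases hk with rfl | hk
  · rw [insertLargest_zero] at h
    cases u with
    | nil =>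
      exfalso
      cases hyz : y ++ z with
      | nil => exact hne hyz
      | cons b l =>
        rw [List.nil_append, hyz, List.cons_append, List.cons.injEq] at h
        exact hy (by rw [hyz, h.1]; simp)
    | cons b u =>
      simp only [List.cons_append, List.cons.injEq] at h
      obtain ⟨rfl, h⟩ := h
      obtain ⟨w, v', rfl, h2, rfl⟩ := List.map_eq_append_iff.1 h
      obtain ⟨w, z', rfl, h3, rfl⟩ := List.map_eq_append_iff.1 h2
      obtain ⟨u', y', rfl, rfl, rfl⟩ := List.map_eq_append_iff.1 h3
      exact ⟨u', y', z', v', rfl, rfl, rfl, by simp [insertLargest_zero]⟩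
  · rw [insertLargest_length hk] at h
    rcases List.eq_nil_or_concat' v with rfl | ⟨v, b, rfl⟩
    · exfalso
      rcases List.eq_nil_or_concat' (y ++ z) with hyz | ⟨l, b, hyz⟩
      · exact hne hyz
      · rw [List.append_nil, List.append_assoc, hyz, ← List.append_assoc] at h
        have := (List.append_inj' h rfl).2
        rw [← this] at hyz
        exact hy (by simp [hyz])
    · rw [← List.append_assoc] at h
      obtain ⟨h, hb⟩ := List.append_inj' h rfl
      obtain ⟨w, v', rfl, h2, rfl⟩ := List.map_eq_append_iff.1 h
      obtain ⟨w, z', rfl, h3, rfl⟩ := List.map_eq_append_iff.1 h2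
      obtain ⟨u', y', rfl, rfl, rfl⟩ := List.map_eq_append_iff.1 h3
      refine ⟨u', y', z', v', rfl, rfl, rfl, ?_⟩
      rw [insertLargest_length (by rw [hk]; simp; omega), ← hb]
      simp

theorem exists_insertLargest_append {k : ℕ} {u v w : List (Fin n)}
    (hk : k = 0 ∨ k = (u ++ w ++ v).length) : ∃ U V : List (Fin (n + 1)),
      ∀ w' : List (Fin n), w'.length = w.length →
        insertLargest (u ++ w' ++ v) k = U ++ w'.map Fin.castSucc ++ V := by
  rcases hk with rfl | hk
  · exact ⟨Fin.last n :: u.map Fin.castSucc, v.map Fin.castSucc,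
      fun w' _ => by simp [insertLargest_zero]⟩
  · refine ⟨u.map Fin.castSucc, v.map Fin.castSucc ++ [Fin.last n], fun w' hw' => ?_⟩
    rw [insertLargest_length (by rw [hk]; simp [hw'])]
    simp

/-- A smaller value cannot pass the largest one, and at an end the largest one is never in its way.
-/
theorem isJump_castSucc_iff {π : List (Fin n)} {k : ℕ} (hk : k = 0 ∨ k = π.length) {dir : Direction}
    {a : Fin n} {d : ℕ} {x : List (Fin (n + 1))} :
    IsJump dir a.castSucc d (insertLargest π k) x ↔
      ∃ ρ, x = insertLargest ρ k ∧ IsJump dir a d π ρ := by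
  have hlast : ∀ s : List (Fin (n + 1)), (∀ x ∈ s, x < a.castSucc) → Fin.last n ∉ s :=
    fun s hs hmem => absurd (hs _ hmem) (Fin.le_last _).not_gt
  have hne := (Fin.castSucc_ne_last a).symm
  have hlt : ∀ s : List (Fin n), (∀ x ∈ s.map Fin.castSucc, x < a.castSucc) ↔ ∀ x ∈ s, x < a := by
    simp
  cases dir with
  | right =>
    constructor
    · rintro ⟨u, s, v, rfl, hd, hs, h, rfl⟩
      obtain ⟨u', y', s', v', rfl, hy, rfl, h'⟩ :=
        exists_swap_of_insertLargest hk h (by simp) (by simp [hlast s hs, hne])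
      obtain ⟨b, rfl⟩ : ∃ b, y' = [b] := by
        rw [← List.length_eq_one_iff]; simpa using (congrArg List.length hy).symm
      obtain rfl : a = b := by simpa using hy
      exact ⟨_, h', u', s', v', by simp, hd, (hlt s').1 hs, rfl, rfl⟩
    · rintro ⟨_, rfl, u, s, v, rfl, hd, hs, rfl, rfl⟩
      obtain ⟨U, V, h⟩ := exists_insertLargest_append (w := [a] ++ s) (u := u) (v := v) (k := k)
        (by simpa using hk)
      have h1 := h ([a] ++ s) rfl
      have h2 := h (s ++ [a]) (by simp)
      refine ⟨U, s.map Fin.castSucc, V, by simp, hd, (hlt s).2 hs, ?_, ?_⟩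
      · simpa using h1
      · simpa using h2
  | left =>
    constructor
    · rintro ⟨u, s, v, rfl, hd, hs, h, rfl⟩
      obtain ⟨u', s', y', v', rfl, rfl, hy, h'⟩ :=
        exists_swap_of_insertLargest hk h (by simp) (by simp [hlast s hs, hne])
      obtain ⟨b, rfl⟩ : ∃ b, y' = [b] := by
        rw [← List.length_eq_one_iff]; simpa using (congrArg List.length hy).symm
      obtain rfl : a = b := by simpa using hy
      exact ⟨_, h', u', s', v', by simp, hd, (hlt s').1 hs, rfl, rfl⟩
    · rintro ⟨_, rfl, u, s, v, rfl, hd, hs, rfl, rfl⟩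
      obtain ⟨U, V, h⟩ := exists_insertLargest_append (w := s ++ [a]) (u := u) (v := v) (k := k)
        (by simpa using hk)
      have h1 := h (s ++ [a]) rfl
      have h2 := h ([a] ++ s) (by simp)
      refine ⟨U, s.map Fin.castSucc, V, by simp, hd, (hlt s).2 hs, ?_, ?_⟩
      · simpa using h1
      · simpa using h2

theorem IsJump.length_eq {dir : Direction} {a : Fin n} {d : ℕ} {π ρ : List (Fin n)}
    (h : IsJump dir a d π ρ) : ρ.length = π.length := by
  cases dir <;> obtain ⟨u, s, v, -, -, -, rfl, rfl⟩ := h <;> simp <;> omega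

theorem IsJump.eq {dir : Direction} {a : Fin n} {d : ℕ} {π ρ ρ' : List (Fin n)} (hπ : π.Nodup)
    (h : IsJump dir a d π ρ) (h' : IsJump dir a d π ρ') : ρ = ρ' := by
  cases dir with
  | right =>
    obtain ⟨u, s, v, hd, -, -, rfl, rfl⟩ := h
    obtain ⟨u', s', v', hd', -, -, he, rfl⟩ := h'
    simp only [List.append_assoc, List.cons_append, List.nil_append] at he hπ
    have hnot := (List.nodup_middle.1 hπ)
    simp only [List.nodup_cons, List.mem_append, not_or] at hnot
    have hnot' := he ▸ hπ
    rw [List.nodup_middle] at hnot'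
    simp only [List.nodup_cons, List.mem_append, not_or] at hnot'
    rw [List.append_cons_inj_of_notMem hnot.1.1 (by simpa using hnot.1.2)] at he
    obtain ⟨rfl, -, he⟩ := he
    obtain ⟨rfl, rfl⟩ := List.append_inj he (hd.trans hd'.symm)
    rfl
  | left =>
    obtain ⟨u, s, v, hd, -, -, rfl, rfl⟩ := h
    obtain ⟨u', s', v', hd', -, -, he, rfl⟩ := h'
    rw [List.append_assoc (u ++ s), List.append_assoc (u' ++ s')] at he
    rw [List.append_assoc (u ++ s)] at hπ
    simp only [List.singleton_append] at he hπ
    have hnot := (List.nodup_middle.1 hπ)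
    rw [List.nodup_cons, List.mem_append, not_or] at hnot
    rw [List.append_cons_inj_of_notMem hnot.1.1 hnot.1.2] at he
    obtain ⟨he, -, rfl⟩ := he
    obtain ⟨rfl, rfl⟩ := List.append_inj' he (hd.trans hd'.symm)
    rfl

end Jump

/-! ### Runs of Algorithm J -/

section Run

variable {n : ℕ} {L : Set (List (Fin n))} {π₀ π ρ ρ' : List (Fin n)} {l l' : List (List (Fin n))}

/-- Determinism of a step: maximality fixes the value, unambiguity the direction, and minimality the
number of steps. -/
theorem IsNext.eq (hL : ∀ π ∈ L, π.Nodup) (hπ : π ∈ L) (h : IsNext L l π ρ)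
    (h' : IsNext L l π ρ') : ρ = ρ' := by
  obtain ⟨a, dir, hc, hmax, hdir⟩ := h
  obtain ⟨a', dir', hc', hmax', -⟩ := h'
  obtain rfl : a = a' := by
    rcases lt_trichotomy a a' with h | h | h
    · exact absurd hc' (hmax _ h _ _)
    · exact h
    · exact absurd hc (hmax' _ h _ _)
  obtain rfl := hdir _ _ hc'
  obtain ⟨⟨d, hj, hm⟩, hρ, -⟩ := hc
  obtain ⟨⟨d', hj', hm'⟩, hρ', -⟩ := hc'
  obtain rfl : d = d' := by
    rcases lt_trichotomy d d' with h | h | h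
    · exact absurd hρ (hm' _ h _ hj)
    · exact h
    · exact absurd hρ' (hm _ h _ hj')
  exact hj.eq (hL π hπ) hj'

theorem IsNext.mem (h : IsNext L l π ρ) : ρ ∈ L ∧ ρ ∉ l := by
  obtain ⟨a, dir, hc, -⟩ := h
  exact hc.2

theorem Run.mem (hπ₀ : π₀ ∈ L) (h : Run L π₀ l π) : π ∈ L := by
  cases h with
  | init => exact hπ₀
  | step _ h => exact h.mem.1

theorem Run.nodup (h : Run L π₀ l π) : l.Nodup := by
  induction h with
  | init => simp
  | step _ h ih =>
    refine List.nodup_append.2 ⟨ih, List.nodup_singleton _, fun x hx y hy he => h.mem.2 ?_⟩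
    rwa [← List.mem_singleton.1 hy, ← he]

theorem Run.ne_nil (h : Run L π₀ l π) : l ≠ [] := by
  cases h <;> simp

theorem Run.eq_of_length_eq (hL : ∀ π ∈ L, π.Nodup) (hπ₀ : π₀ ∈ L) (h : Run L π₀ l π)
    (h' : Run L π₀ l' ρ) (hl : l.length = l'.length) : l = l' ∧ π = ρ := by
  induction h generalizing l' ρ with
  | init =>
    cases h' with
    | init => exact ⟨rfl, rfl⟩
    | step h _ =>
      have := List.length_pos_of_ne_nil h.ne_nil
      simp only [List.length_append, List.length_singleton] at hl
      omega
  | step h hn ih =>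
    cases h' with
    | init =>
      have := List.length_pos_of_ne_nil h.ne_nil
      simp only [List.length_append, List.length_singleton] at hl
      omega
    | step h' hn' =>
      obtain ⟨rfl, rfl⟩ := ih h' (by simpa using hl)
      obtain rfl := hn.eq hL (h.mem hπ₀) hn'
      exact ⟨rfl, rfl⟩

theorem Run.exists_isNext_of_lt (h : Run L π₀ l π) {m : ℕ} (hm : 0 < m) (hml : m < l.length) :
    ∃ l' π' π'', Run L π₀ l' π' ∧ l'.length = m ∧ IsNext L l' π' π'' := by
  induction h with
  | init => simp at hml; omega
  | @step l π π' h hn ih =>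
    rcases lt_or_ge m l.length with hlt | hge
    · exact ih hlt
    · refine ⟨l, π, π', h, ?_, hn⟩
      simp at hml
      omega

/-- If one terminated run were shorter, the longer one would pass through its final state and
continue from there. -/
theorem Generates.eq (hL : ∀ π ∈ L, π.Nodup) (hπ₀ : π₀ ∈ L) (h : Generates L π₀ l)
    (h' : Generates L π₀ l') : l = l' := by
  have key : ∀ {l l' : List (List (Fin n))}, Generates L π₀ l → Generates L π₀ l' →
      l'.length ≤ l.length := by
    rintro l l' ⟨π, hr, hend⟩ ⟨π', hr', -⟩
    by_contra! hlt
    obtain ⟨l₁, ρ, ρ', hr₁, hlen, hn⟩ :=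
      hr'.exists_isNext_of_lt (List.length_pos_of_ne_nil hr.ne_nil) hlt
    obtain ⟨rfl, rfl⟩ := hr.eq_of_length_eq hL hπ₀ hr₁ hlen.symm
    exact hend _ hn
  have hle := key h h'
  have hge := key h' h
  obtain ⟨π, hr, -⟩ := h
  obtain ⟨π', hr', -⟩ := h'
  exact (hr.eq_of_length_eq hL hπ₀ hr' (le_antisymm hge hle)).1

end Run

/-! ### Lifting runs to one more vertex -/

section Lift

variable {n : ℕ} {G : SimpleGraph (Fin (n + 1))} {π ρ : List (Fin n)} {k p q : ℕ}
  {V : List (List (Fin (n + 1)))} {l : List (List (Fin n))}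

/-- The first and the last slot. -/
def IsEndSlot (G : SimpleGraph (Fin (n + 1))) (k : ℕ) : Prop := k = firstSlot G ∨ k = n

theorem IsEndSlot.eq_zero_or_eq (hk : IsEndSlot G k) : k = 0 ∨ k = n := by
  rcases hk with rfl | rfl
  · exact firstSlot_eq G
  · exact Or.inr rfl

theorem IsEndSlot.mem_slots (hk : IsEndSlot G k) : k ∈ slots G π := by
  rcases hk with rfl | rfl
  · exact firstSlot_mem_slots
  · exact last_mem_slots

theorem IsEndSlot.le (hk : IsEndSlot G k) : k ≤ n :=
  le_of_mem_slots (hk.mem_slots (π := []))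

theorem IsEndSlot.insertLargest_mem_iff (hG : IsPerfectEliminationOrder G) (hk : IsEndSlot G k)
    (hρ : ρ.length = n) :
    insertLargest ρ k ∈ encodings G ↔ ρ ∈ encodings (deleteLastGraph G) := by
  rw [insertLargest_mem_encodings_iff hG hρ hk.le]
  exact and_iff_left hk.mem_slots

theorem isMinimalJump_castSucc_iff (hG : IsPerfectEliminationOrder G) (hk : IsEndSlot G k)
    (hπ : π.length = n) {dir : Direction} {a : Fin n} {x : List (Fin (n + 1))} :
    IsMinimalJump (encodings G) dir a.castSucc (insertLargest π k) x ↔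
      ∃ ρ, x = insertLargest ρ k ∧ ρ.length = n ∧
        IsMinimalJump (encodings (deleteLastGraph G)) dir a π ρ := by
  have hk' : k = 0 ∨ k = π.length := hπ.symm ▸ hk.eq_zero_or_eq
  constructor
  · rintro ⟨d, hj, hmin⟩
    obtain ⟨ρ, rfl, hj₁⟩ := (isJump_castSucc_iff hk').1 hj
    refine ⟨ρ, rfl, hj₁.length_eq.trans hπ, d, hj₁, fun d' hd' ρ' hj' hmem => ?_⟩
    exact hmin d' hd' (insertLargest ρ' k) ((isJump_castSucc_iff hk').2 ⟨ρ', rfl, hj'⟩)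
      ((hk.insertLargest_mem_iff hG (hj'.length_eq.trans hπ)).2 hmem)
  · rintro ⟨ρ, rfl, -, d, hj, hmin⟩
    refine ⟨d, (isJump_castSucc_iff hk').2 ⟨ρ, rfl, hj⟩, fun d' hd' x hj' hmem => ?_⟩
    obtain ⟨ρ', rfl, hj₁⟩ := (isJump_castSucc_iff hk').1 hj'
    exact hmin d' hd' ρ' hj₁ ((hk.insertLargest_mem_iff hG (hj₁.length_eq.trans hπ)).1 hmem)

theorem isCandidate_castSucc_iff (hG : IsPerfectEliminationOrder G) (hk : IsEndSlot G k)
    (hπ : π.length = n)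
    (hV : ∀ ρ ∈ encodings (deleteLastGraph G), insertLargest ρ k ∈ V ↔ ρ ∈ l)
    {dir : Direction} {a : Fin n} {x : List (Fin (n + 1))} :
    IsCandidate (encodings G) V dir a.castSucc (insertLargest π k) x ↔
      ∃ ρ, x = insertLargest ρ k ∧ IsCandidate (encodings (deleteLastGraph G)) l dir a π ρ := by
  constructor
  · rintro ⟨hm, hx, hxV⟩
    obtain ⟨ρ, rfl, hρ, hm⟩ := (isMinimalJump_castSucc_iff hG hk hπ).1 hm
    have hx := (hk.insertLargest_mem_iff hG hρ).1 hx
    exact ⟨ρ, rfl, hm, hx, fun h => hxV ((hV ρ hx).2 h)⟩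
  · rintro ⟨ρ, rfl, hm, hρ, hρl⟩
    have hlen := length_of_mem_encodings hρ
    exact ⟨(isMinimalJump_castSucc_iff hG hk hπ).2 ⟨ρ, rfl, hlen, hm⟩,
      (hk.insertLargest_mem_iff hG hlen).2 hρ, fun h => hρl ((hV ρ hρ).1 h)⟩

theorem exists_of_isCandidate_last (hG : IsPerfectEliminationOrder G) (hπ : π.length = n)
    (hp : p ≤ n) {dir : Direction} {x : List (Fin (n + 1))}
    (h : IsCandidate (encodings G) V dir (Fin.last n) (insertLargest π p) x) :
    ∃ q ∈ slots G π, x = insertLargest π q ∧ x ∉ V ∧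
      (dir = .right ∧ p < q ∨ dir = .left ∧ q < p) := by
  obtain ⟨⟨d, hj, -⟩, hx, hxV⟩ := h
  cases dir with
  | right =>
    obtain ⟨hd, hle, rfl⟩ := (isJump_right_last_iff (hp.trans hπ.ge)).1 hj
    refine ⟨p + d, ((insertLargest_mem_encodings_iff hG hπ (hle.trans hπ.le)).1 hx).2, rfl, hxV,
      Or.inl ⟨rfl, by omega⟩⟩
  | left =>
    obtain ⟨hd, hle, rfl⟩ := (isJump_left_last_iff (hp.trans hπ.ge)).1 hj
    refine ⟨p - d, ((insertLargest_mem_encodings_iff hG hπ (by omega)).1 hx).2, rfl, hxV,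
      Or.inr ⟨rfl, by omega⟩⟩

/-- Once all insertions of the largest value into `π` are visited, Algorithm J proceeds as it does
without the largest value. -/
theorem isNext_insertLargest_iff (hG : IsPerfectEliminationOrder G) (hk : IsEndSlot G k)
    (hπ : π.length = n)
    (hV : ∀ ρ ∈ encodings (deleteLastGraph G), insertLargest ρ k ∈ V ↔ ρ ∈ l)
    (hall : ∀ p ∈ slots G π, insertLargest π p ∈ V) {x : List (Fin (n + 1))} :
    IsNext (encodings G) V (insertLargest π k) x ↔
      ∃ ρ, x = insertLargest ρ k ∧ IsNext (encodings (deleteLastGraph G)) l π ρ := by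
  have hlast : ∀ dir x, ¬ IsCandidate (encodings G) V dir (Fin.last n) (insertLargest π k) x := by
    intro dir x h
    obtain ⟨q, hq, rfl, hqV, -⟩ := exists_of_isCandidate_last hG hπ hk.le h
    exact hqV (hall q hq)
  have hcast := fun (dir : Direction) (a : Fin n) (x : List (Fin (n + 1))) =>
    isCandidate_castSucc_iff hG hk hπ hV (dir := dir) (a := a) (x := x)
  constructor
  · rintro ⟨a, dir, hc, hmax, hdir⟩
    induction a using Fin.lastCases with
    | last => exact absurd hc (hlast _ _)
    | cast a =>
      obtain ⟨ρ, rfl, hρ⟩ := (hcast _ _ _).1 hc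
      refine ⟨ρ, rfl, a, dir, hρ, fun b hb dir' ρ' hc' => ?_, fun dir' ρ' hc' => ?_⟩
      · exact hmax b.castSucc (by simpa using hb) dir' _ ((hcast _ _ _).2 ⟨ρ', rfl, hc'⟩)
      · exact hdir dir' _ ((hcast _ _ _).2 ⟨ρ', rfl, hc'⟩)
  · rintro ⟨ρ, rfl, a, dir, hc, hmax, hdir⟩
    refine ⟨a.castSucc, dir, (hcast _ _ _).2 ⟨ρ, rfl, hc⟩, fun b hb dir' x hc' => ?_,
      fun dir' x hc' => ?_⟩
    · induction b using Fin.lastCases with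
      | last => exact hlast _ _ hc'
      | cast b =>
        obtain ⟨ρ', -, hρ'⟩ := (hcast _ _ _).1 hc'
        exact hmax b (by simpa using hb) dir' ρ' hρ'
    · obtain ⟨ρ', -, hρ'⟩ := (hcast _ _ _).1 hc'
      exact hdir dir' ρ' hρ'

/-- Algorithm J moves the largest value to the next slot in the direction in which there are
unvisited permutations. -/
theorem isNext_slot (hG : IsPerfectEliminationOrder G)
    (hπ : π ∈ encodings (deleteLastGraph G)) (hp : p ∈ slots G π) (hq : q ∈ slots G π)
    (hpq : p ≠ q) (hqV : insertLargest π q ∉ V)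
    (hbetween : ∀ r ∈ slots G π, ¬ (p < r ∧ r < q) ∧ ¬ (q < r ∧ r < p))
    (hother : ∀ r ∈ slots G π, r ≠ p → insertLargest π r ∉ V → (p < r ↔ p < q)) :
    IsNext (encodings G) V (insertLargest π p) (insertLargest π q) := by
  have hlen := length_of_mem_encodings hπ
  have hpn := le_of_mem_slots hp
  have hqn := le_of_mem_slots hq
  have hqL := (insertLargest_mem_encodings_iff hG hlen hqn).2 ⟨hπ, hq⟩
  have hdir : ∀ dir x, IsCandidate (encodings G) V dir (Fin.last n) (insertLargest π p) x →
      (dir = .right ∧ p < q ∨ dir = .left ∧ ¬ p < q) := by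
    intro dir x h
    obtain ⟨r, hr, rfl, hrV, hr'⟩ := exists_of_isCandidate_last hG hlen hpn h
    rcases hr' with ⟨rfl, hlt⟩ | ⟨rfl, hlt⟩
    · exact Or.inl ⟨rfl, (hother r hr hlt.ne' hrV).1 hlt⟩
    · exact Or.inr ⟨rfl, fun h' => absurd ((hother r hr hlt.ne hrV).2 h') (by omega)⟩
  rcases hpq.lt_or_gt with hlt | hlt
  · refine ⟨Fin.last n, .right, ⟨⟨q - p, ?_, ?_⟩, hqL, hqV⟩, fun b hb => ?_, fun dir x h => ?_⟩
    · exact (isJump_right_last_iff (hpn.trans hlen.ge)).2 ⟨by omega, by omega, by congr 1; omega⟩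
    · intro d hd x hj hx
      obtain ⟨h1, h2, rfl⟩ := (isJump_right_last_iff (hpn.trans hlen.ge)).1 hj
      have := hbetween _ ((insertLargest_mem_encodings_iff hG hlen (h2.trans hlen.le)).1 hx).2
      omega
    · exact absurd hb (Fin.le_last b).not_gt
    · rcases hdir dir x h with h | h
      · exact h.1
      · exact absurd hlt h.2
  · refine ⟨Fin.last n, .left, ⟨⟨p - q, ?_, ?_⟩, hqL, hqV⟩, fun b hb => ?_, fun dir x h => ?_⟩
    · exact (isJump_left_last_iff (hpn.trans hlen.ge)).2 ⟨by omega, by omega, by congr 1; omega⟩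
    · intro d hd x hj hx
      obtain ⟨h1, h2, rfl⟩ := (isJump_left_last_iff (hpn.trans hlen.ge)).1 hj
      have := hbetween _ ((insertLargest_mem_encodings_iff hG hlen (by omega)).1 hx).2
      omega
    · exact absurd hb (Fin.le_last b).not_gt
    · rcases hdir dir x h with h | h
      · exact absurd h.2 hlt.not_gt
      · exact h.1

/-! ### Sweeps of the largest value through its slots -/

/-- A list of all slots in increasing or decreasing order. -/
structure IsSweep (G : SimpleGraph (Fin (n + 1))) (π : List (Fin n)) (qs : List ℕ) : Prop where
  pairwise : qs.Pairwise (· < ·) ∨ qs.Pairwise (· > ·)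
  mem_iff : ∀ p, p ∈ qs ↔ p ∈ slots G π

theorem IsSweep.nodup {qs : List ℕ} (h : IsSweep G π qs) : qs.Nodup := by
  rcases h.pairwise with h | h
  · exact h.imp fun h => h.ne
  · exact h.imp fun h => h.ne'

/-- Nothing lies between consecutive slots, which makes the jump minimal, and all slots still ahead
are on one side, which makes its direction unambiguous. -/
theorem IsSweep.consecutive {xs ys : List ℕ} (h : IsSweep G π (xs ++ p :: q :: ys)) {r : ℕ}
    (hr : r ∈ slots G π) : (¬ (p < r ∧ r < q) ∧ ¬ (q < r ∧ r < p)) ∧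
      (r ∉ xs → r ≠ p → (p < r ↔ p < q)) := by
  have hmem := (h.mem_iff r).2 hr
  have hpw := h.pairwise
  simp only [List.pairwise_append, List.pairwise_cons, List.mem_cons, forall_eq_or_imp] at hpw
  simp only [List.mem_append, List.mem_cons] at hmem
  rcases hpw with ⟨-, ⟨⟨h1, h2⟩, h3, -⟩, h4⟩ | ⟨-, ⟨⟨h1, h2⟩, h3, -⟩, h4⟩
  · rcases hmem with hx | rfl | rfl | hy
    · have := h4 r hx
      exact ⟨by omega, fun h => absurd hx h⟩
    · exact ⟨by omega, fun _ h => absurd rfl h⟩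
    · exact ⟨by omega, fun _ _ => Iff.rfl⟩
    · have := h3 r hy
      have := h2 r hy
      exact ⟨by omega, fun _ _ => by omega⟩
  · rcases hmem with hx | rfl | rfl | hy
    · have := h4 r hx
      exact ⟨by omega, fun h => absurd hx h⟩
    · exact ⟨by omega, fun _ h => absurd rfl h⟩
    · exact ⟨by omega, fun _ _ => Iff.rfl⟩
    · have := h3 r hy
      have := h2 r hy
      exact ⟨by omega, fun _ _ => by omega⟩

theorem exists_isSweep (hk : IsEndSlot G k) :
    ∃ tl k', IsSweep G π (k :: tl) ∧ IsEndSlot G k' ∧ (k :: tl).getLast? = some k' := by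
  -- Stated for a general relation, to serve both the increasing sweep from the first slot and the
  -- decreasing one from the last.
  have key : ∀ (R : ℕ → ℕ → Prop) (l : List ℕ) (lo hi : ℕ), l.Pairwise R →
      (∀ p, p ∈ l ↔ p ∈ slots G π) → lo ∈ slots G π → hi ∈ slots G π →
      (∀ r ∈ slots G π, ¬ R r lo) → (∀ r ∈ slots G π, ¬ R hi r) →
      ∃ tl, l = lo :: tl ∧ (lo :: tl).getLast? = some hi := by
    intro R l lo hi hR hmem hlo hhi h1 h2
    cases l with
    | nil => exact absurd ((hmem lo).2 hlo) (by simp)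
    | cons a tl =>
      obtain rfl : a = lo := by
        rcases List.mem_cons.1 ((hmem lo).2 hlo) with h | h
        · exact h.symm
        · exact absurd ((List.pairwise_cons.1 hR).1 lo h) (h1 a ((hmem a).1 (by simp)))
      refine ⟨tl, rfl, ?_⟩
      rcases List.eq_nil_or_concat' (a :: tl) with h | ⟨init, b, h⟩
      · simp at h
      · rw [h] at hR hmem ⊢
        rw [List.getLast?_append]
        rcases List.mem_append.1 ((hmem hi).2 hhi) with h' | h'
        · exact absurd ((List.pairwise_append.1 hR).2.2 hi h' b (by simp))
            (h2 b ((hmem b).1 (by simp)))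
        · rw [List.mem_singleton.1 h']; rfl
  rcases hk with rfl | rfl
  · obtain ⟨tl, h, hlast⟩ := key (· < ·) ((slots G π).sort (· ≤ ·)) (firstSlot G) n
      (Finset.sortedLT_sort _).pairwise (by simp) firstSlot_mem_slots last_mem_slots
      (fun r hr => (firstSlot_le_of_mem_slots hr).not_gt) (fun r hr => (le_of_mem_slots hr).not_gt)
    exact ⟨tl, n, h ▸ ⟨Or.inl (Finset.sortedLT_sort _).pairwise, by simp⟩, Or.inr rfl, hlast⟩
  · obtain ⟨tl, h, hlast⟩ := key (· > ·) ((slots G π).sort (· ≥ ·)) k (firstSlot G)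
      (Finset.sortedGT_sort _).pairwise (by simp) last_mem_slots firstSlot_mem_slots
      (fun r hr => (le_of_mem_slots hr).not_gt) (fun r hr => (firstSlot_le_of_mem_slots hr).not_gt)
    exact ⟨tl, _, h ▸ ⟨Or.inr (Finset.sortedGT_sort _).pairwise, by simp⟩, Or.inl rfl, hlast⟩

/-- Here `V` consists of the permutations visited before the sweep, none of which is an insertion
into `π` at a slot. -/
theorem run_sweep_prefix (hG : IsPerfectEliminationOrder G) {π₀ : List (Fin (n + 1))}
    (hπ : π ∈ encodings (deleteLastGraph G)) {tl : List ℕ} (hs : IsSweep G π (k :: tl))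
    (hV : ∀ p ∈ slots G π, insertLargest π p ∉ V)
    (hrun : Run (encodings G) π₀ (V ++ [insertLargest π k]) (insertLargest π k))
    (xs : List ℕ) : ∀ q ys, k :: tl = xs ++ q :: ys →
      Run (encodings G) π₀ (V ++ (xs ++ [q]).map (insertLargest π)) (insertLargest π q) := by
  have hlen := length_of_mem_encodings hπ
  induction xs using List.reverseRecOn with
  | nil =>
    rintro q ys h
    obtain ⟨rfl, -⟩ := List.cons.inj h
    simpa using hrun
  | append_singleton xs p ih =>
    intro q ys h
    have h' : k :: tl = xs ++ p :: q :: ys := by simpa using h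
    have hs' := h' ▸ hs
    have hpS : p ∈ slots G π := (hs'.mem_iff p).1 (by simp)
    have hqS : q ∈ slots G π := (hs'.mem_iff q).1 (by simp)
    have hinj : ∀ {r s}, r ∈ slots G π → s ∈ slots G π → insertLargest π r = insertLargest π s →
        r = s := fun hr hs' he => (insertLargest_injective ((le_of_mem_slots hr).trans hlen.ge)
          ((le_of_mem_slots hs').trans hlen.ge) he).2
    have hnd := hs'.nodup
    rw [List.map_append, ← List.append_assoc]
    refine (ih p (q :: ys) h').step (isNext_slot hG hπ hpS hqS ?_ ?_ ?_ ?_)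
    · rintro rfl
      simp [List.nodup_append] at hnd
    · rw [List.mem_append, not_or]
      refine ⟨hV q hqS, fun hmem => ?_⟩
      obtain ⟨r, hr, he⟩ := List.mem_map.1 hmem
      have hrS : r ∈ slots G π := (hs'.mem_iff r).1 (by
        simp only [List.mem_append, List.mem_cons, List.not_mem_nil, or_false] at hr ⊢
        tauto)
      obtain rfl := hinj hrS hqS he
      rw [List.append_cons, List.nodup_append] at hnd
      exact hnd.2.2 r hr r (by simp) rfl
    · exact fun r hr => (hs'.consecutive hr).1
    · refine fun r hr hne hrV => (hs'.consecutive hr).2 (fun hrx => hrV ?_) hne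
      exact List.mem_append_right _ (List.mem_map_of_mem (by simp [hrx]))

theorem run_sweep (hG : IsPerfectEliminationOrder G) {π₀ : List (Fin (n + 1))}
    (hπ : π ∈ encodings (deleteLastGraph G)) {tl : List ℕ} (hs : IsSweep G π (k :: tl))
    {k' : ℕ} (hlast : (k :: tl).getLast? = some k')
    (hV : ∀ p ∈ slots G π, insertLargest π p ∉ V)
    (hrun : Run (encodings G) π₀ (V ++ [insertLargest π k]) (insertLargest π k)) :
    Run (encodings G) π₀ (V ++ (k :: tl).map (insertLargest π)) (insertLargest π k') := by
  obtain ⟨xs, h⟩ := List.getLast?_eq_some_iff.1 hlast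
  have := run_sweep_prefix hG hπ hs hV hrun xs k' [] h
  rwa [← h] at this

theorem isChain_sweep (hG : IsPerfectEliminationOrder G)
    (D : AcyclicOrientation (deleteLastGraph G)) {qs : List ℕ} (hs : IsSweep G (encode D.1) qs) :
    (qs.map (D.extendLast hG)).IsChain (flipGraph G).Adj := by
  have key : ∀ ys xs, qs = xs ++ ys → (ys.map (D.extendLast hG)).IsChain (flipGraph G).Adj := by
    intro ys
    induction ys with
    | nil => simp
    | cons p ys ih =>
      intro xs h
      cases ys with
      | nil => simp
      | cons q ys =>
        refine List.IsChain.cons_cons ?_ (ih (xs ++ [p]) (by simpa using h))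
        have hs' := h ▸ hs
        have hpS := (hs'.mem_iff p).1 (by simp)
        have hqS := (hs'.mem_iff q).1 (by simp)
        have hne : p ≠ q := by
          rintro rfl
          have := hs'.nodup
          simp [List.nodup_append] at this
        rcases hne.lt_or_gt with hlt | hlt
        · refine isArcFlip_extendLast_of_lt hpS hqS hlt fun r hr => ?_
          have := (hs'.consecutive hr).1
          omega
        · refine (flipGraph G).symm.symm _ _ (isArcFlip_extendLast_of_lt hqS hpS hlt fun r hr => ?_)
          have := (hs'.consecutive hr).1
          omega
  exact key qs [] rfl

theorem mem_map_extendLast_iff (hG : IsPerfectEliminationOrder G)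
    {D : AcyclicOrientation (deleteLastGraph G)} {qs : List ℕ} (hs : IsSweep G (encode D.1) qs)
    (E : AcyclicOrientation G) : E ∈ qs.map (D.extendLast hG) ↔ E.deleteLast = D := by
  constructor
  · intro h
    obtain ⟨p, -, rfl⟩ := List.mem_map.1 h
    exact AcyclicOrientation.deleteLast_extendLast hG D p
  · rintro rfl
    obtain ⟨p, hp, h⟩ := E.exists_extendLast_eq hG
    exact List.mem_map.2 ⟨p, (hs.mem_iff p).2 hp, h.symm⟩

theorem map_encode_extendLast (hG : IsPerfectEliminationOrder G)
    {D : AcyclicOrientation (deleteLastGraph G)} {qs : List ℕ} (hs : IsSweep G (encode D.1) qs) :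
    (qs.map (D.extendLast hG)).map (fun E => encode E.1) = qs.map (insertLargest (encode D.1)) := by
  rw [List.map_map]
  exact List.map_congr_left fun p hp => D.encode_extendLast hG ((hs.mem_iff p).1 hp)

theorem mem_map_encode_iff {m : ℕ} {H : SimpleGraph (Fin m)} (hH : IsPerfectEliminationOrder H)
    {l : List (AcyclicOrientation H)} {D : AcyclicOrientation H} :
    encode D.1 ∈ l.map (fun E => encode E.1) ↔ D ∈ l :=
  List.mem_map_of_injective (encode_injective hH) (a := D)

/-- If the extensions of each smaller orientation are visited all or none, visits can be tested at
any slot. -/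
theorem insertLargest_mem_map_encode_iff (hG : IsPerfectEliminationOrder G)
    {l : List (AcyclicOrientation G)} {l' : List (AcyclicOrientation (deleteLastGraph G))}
    (hl : ∀ D : AcyclicOrientation G, D ∈ l ↔ D.deleteLast ∈ l')
    (D : AcyclicOrientation (deleteLastGraph G)) (hp : p ∈ slots G (encode D.1)) :
    insertLargest (encode D.1) p ∈ l.map (fun E => encode E.1) ↔
      encode D.1 ∈ l'.map (fun E => encode E.1) := by
  rw [← D.encode_extendLast hG hp, mem_map_encode_iff hG, mem_map_encode_iff hG.deleteLast, hl,
    AcyclicOrientation.deleteLast_extendLast]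

/-- A run of Algorithm J lifts to one more vertex. -/
theorem exists_lift_of_run (hG : IsPerfectEliminationOrder G) {π₀ : List (Fin n)}
    (hk : IsEndSlot G k)
    (hrun : Run (encodings (deleteLastGraph G)) π₀ l π) :
    ∀ l' : List (AcyclicOrientation (deleteLastGraph G)), l = l'.map (fun D => encode D.1) →
    l'.IsChain (flipGraph (deleteLastGraph G)).Adj →
    ∃ (m : List (AcyclicOrientation G)) (D : AcyclicOrientation (deleteLastGraph G)) (k' : ℕ),
      IsEndSlot G k' ∧ l'.getLast? = some D ∧ π = encode D.1 ∧ m.IsChain (flipGraph G).Adj ∧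
      m.getLast? = some (D.extendLast hG k') ∧
      Run (encodings G) (insertLargest π₀ k) (m.map fun D => encode D.1) (insertLargest π k') ∧
      ∀ E : AcyclicOrientation G, E ∈ m ↔ E.deleteLast ∈ l' := by
  induction hrun with
  | init =>
    intro l' hl' _
    obtain ⟨D, rfl, hD⟩ := List.map_eq_singleton_iff.1 hl'.symm
    obtain ⟨tl, k', hs, hk', hlast⟩ := exists_isSweep (π := encode D.1) hk
    refine ⟨(k :: tl).map (D.extendLast hG), D, k', hk', rfl, hD.symm, isChain_sweep hG D hs,
      by rw [List.getLast?_map, hlast]; rfl, ?_, fun E => ?_⟩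
    · rw [map_encode_extendLast hG hs, ← hD]
      exact run_sweep (V := []) hG ⟨D, rfl⟩ hs hlast (by simp) Run.init
    · rw [mem_map_extendLast_iff hG hs, List.mem_singleton]
  | @step l π ρ hrun hn ih =>
    intro l' hl' hchain
    obtain ⟨l₁, l₂, rfl, hl₁, hl₂⟩ := List.map_eq_append_iff.1 hl'.symm
    obtain ⟨E, rfl, rfl⟩ := List.map_eq_singleton_iff.1 hl₂
    rw [List.isChain_append] at hchain
    obtain ⟨m, D, k', hk', hD, rfl, hm, hmlast, hmrun, hmem⟩ := ih l₁ hl₁.symm hchain.1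
    obtain ⟨tl, k'', hs, hk'', hlast⟩ := exists_isSweep (π := encode E.1) hk'
    have hE : E ∉ l₁ := by
      rw [← mem_map_encode_iff hG.deleteLast, hl₁]
      exact hn.mem.2
    have hDmem : D ∈ l₁ := List.mem_of_getLast? hD
    -- All insertions into the encoding of `D` are exhausted, so a smaller value jumps while the
    -- largest one rests at `k'`, where the next sweep begins.
    have hstep : IsNext (encodings G) (m.map fun D => encode D.1) (insertLargest (encode D.1) k')
        (insertLargest (encode E.1) k') := by
      refine (isNext_insertLargest_iff hG hk' (length_encode _) (l := l) ?_ ?_).2 ⟨_, rfl, hn⟩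
      · rintro _ ⟨F, rfl⟩
        rw [← hl₁]
        exact insertLargest_mem_map_encode_iff hG hmem F hk'.mem_slots
      · intro p hp
        rw [insertLargest_mem_map_encode_iff hG hmem D hp]
        exact (mem_map_encode_iff hG.deleteLast).2 hDmem
    refine ⟨m ++ (k' :: tl).map (E.extendLast hG), E, k'', hk'', by simp, rfl, ?_, ?_, ?_, ?_⟩
    · refine List.isChain_append.2 ⟨hm, isChain_sweep hG E hs, ?_⟩
      rintro x hx y hy
      rw [hmlast] at hx
      obtain rfl : D.extendLast hG k' = x := by simpa using hx
      obtain rfl : E.extendLast hG k' = y := by simpa using hy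
      exact (hchain.2.2 D hD E (by simp) : IsArcFlip D.1 E.1).extendLast hk'.eq_zero_or_eq
    · rw [List.getLast?_append, List.getLast?_map, hlast]; rfl
    · rw [List.map_append, map_encode_extendLast hG hs]
      refine run_sweep hG ⟨E, rfl⟩ hs hlast ?_ (hmrun.step hstep)
      intro p hp
      rw [insertLargest_mem_map_encode_iff hG hmem E hp, mem_map_encode_iff hG.deleteLast]
      exact hE
    · intro F
      rw [List.mem_append, List.mem_append, hmem, mem_map_extendLast_iff hG hs, List.mem_singleton]

/-! ### Peak-free starting points and the induction on the number of vertices -/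

theorem PeakFree.eq_zero_or_eq (h : PeakFree (insertLargest π p)) (hp : p ≤ π.length) :
    p = 0 ∨ p = π.length := by
  by_contra! hcon
  obtain ⟨A, B, rfl, rfl⟩ := exists_append_of_le hp
  rcases List.eq_nil_or_concat' A with rfl | ⟨A, x, rfl⟩
  · simp at hcon
  · cases B with
    | nil => simp at hcon
    | cons z B =>
      refine h x.castSucc (Fin.last n) z.castSucc ?_ ⟨Fin.castSucc_lt_last x, Fin.castSucc_lt_last z⟩
      rw [insertLargest_append]
      exact ⟨A.map Fin.castSucc, B.map Fin.castSucc, by simp⟩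

theorem PeakFree.of_insertLargest (h : PeakFree (insertLargest π p))
    (hp : p = 0 ∨ p = π.length) : PeakFree π := by
  intro x y z hxyz hlt
  refine h x.castSucc y.castSucc z.castSucc ?_ (by simpa using hlt)
  have h1 : [x.castSucc, y.castSucc, z.castSucc] <:+: π.map Fin.castSucc := hxyz.map Fin.castSucc
  rcases hp with rfl | hp
  · rw [insertLargest_zero]
    exact h1.trans (List.suffix_cons _ _).isInfix
  · rw [insertLargest_length hp]
    exact h1.trans (List.prefix_append _ _).isInfix

end Lift

/-- Algorithm J visits the encodings of the vertices of a Hamilton path in the flip graph. -/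
theorem exists_generates : ∀ {n : ℕ} {G : SimpleGraph (Fin n)}, IsPerfectEliminationOrder G →
    ∀ π₀ ∈ encodings G, PeakFree π₀ → ∃ m : List (AcyclicOrientation G),
      m.IsChain (flipGraph G).Adj ∧ (∀ D, D ∈ m) ∧
      Generates (encodings G) π₀ (m.map fun D => encode D.1)
  | 0, G, hG, π₀, hπ₀, _ => by
    obtain ⟨D, rfl⟩ := hπ₀
    refine ⟨[D], by simp, fun E => ?_, _, Run.init, ?_⟩
    · rw [List.mem_singleton]
      exact encode_injective hG (by simp [encode])
    · rintro π ⟨a, -⟩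
      exact a.elim0
  | n + 1, G, hG, π₀, hπ₀, hpf => by
    obtain ⟨ρ, hρ, p, hp, rfl⟩ := exists_insertLargest_of_mem_encodings hG hπ₀
    have hlen := length_of_mem_encodings hρ
    have hends := hpf.eq_zero_or_eq ((le_of_mem_slots hp).trans hlen.ge)
    have hk : IsEndSlot G p := by
      rcases hends with rfl | h
      · exact Or.inl (Nat.le_zero.1 (firstSlot_le_of_mem_slots hp)).symm
      · exact Or.inr (h.trans hlen)
    obtain ⟨l, hchain, hall, π, hrun, hend⟩ :=
      exists_generates hG.deleteLast ρ hρ (hpf.of_insertLargest hends)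
    obtain ⟨m, D, k, hk', -, rfl, hm, -, hmrun, hmem⟩ :=
      exists_lift_of_run hG hk hrun l rfl hchain
    -- All encodings are visited, so a further step would come from a further step of the smaller
    -- run, which has terminated.
    refine ⟨m, hm, fun E => (hmem E).2 (hall _), _, hmrun, fun x hx => ?_⟩
    have hvisited : ∀ σ ∈ encodings (deleteLastGraph G), insertLargest σ k ∈
        m.map (fun E => encode E.1) ↔ σ ∈ l.map (fun E => encode E.1) := by
      rintro _ ⟨F, rfl⟩
      exact insertLargest_mem_map_encode_iff hG hmem F hk'.mem_slots
    have hslots : ∀ q ∈ slots G (encode D.1), insertLargest (encode D.1) q ∈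
        m.map (fun E => encode E.1) := by
      intro q hq
      rw [insertLargest_mem_map_encode_iff hG hmem D hq]
      exact (mem_map_encode_iff hG.deleteLast).2 (hall D)
    obtain ⟨σ, -, hσ⟩ :=
      (isNext_insertLargest_iff hG hk' (length_encode _) hvisited hslots).1 hx
    exact hend σ hσ

/-- The identity permutation encodes an acyclic orientation. -/
theorem finRange_mem_encodings : ∀ {n : ℕ} {G : SimpleGraph (Fin n)},
    IsPerfectEliminationOrder G → List.finRange n ∈ encodings G
  | 0, _, _ => ⟨⟨⟨fun _ _ => False⟩, ⟨fun u => u.elim0, fun u => u.elim0⟩, fun u => u.elim0⟩, rfl⟩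
  | n + 1, G, hG => by
    have h := (insertLargest_mem_encodings_iff hG (List.length_finRange (n := n)) le_rfl).2
      ⟨finRange_mem_encodings hG.deleteLast, last_mem_slots⟩
    rwa [insertLargest_length (by simp), ← List.finRange_succ_last] at h

end AcyclicGray

theorem mainTheorem5 {n : ℕ} (G : SimpleGraph (Fin n)) (hG : IsPerfectEliminationOrder G) :
    List.finRange n ∈ encodings G ∧
    ∃ φ : flipGraph G ≃g skeleton (graphicalZonotope G),
      (∀ D : AcyclicOrientation G, (φ D : Fin n → ℝ) = inDegrees D.1) ∧
      ∀ π₀ ∈ encodings G, PeakFree π₀ →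
        ∃ (D D' : AcyclicOrientation G) (w : (flipGraph G).Walk D D'),
          w.IsHamiltonian ∧ (w.map φ.toHom).IsHamiltonian ∧
          ∀ l : List (List (Fin n)),
            Generates (encodings G) π₀ l ↔ l = w.support.map (fun D => encode D.1) := by
  refine ⟨finRange_mem_encodings hG, ?_⟩
  obtain ⟨φ, hφ⟩ := exists_flipGraph_iso_skeleton G
  refine ⟨φ, hφ, fun π₀ hπ₀ hpf => ?_⟩
  obtain ⟨m, hchain, hall, hgen⟩ := exists_generates hG π₀ hπ₀ hpf
  have hne : m ≠ [] := by
    obtain ⟨D, -⟩ := hπ₀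
    exact List.ne_nil_of_mem (hall D)
  -- Algorithm J never revisits a permutation, so no orientation is repeated.
  have hnodup : m.Nodup := by
    obtain ⟨π, hrun, -⟩ := hgen
    exact hrun.nodup.of_map _
  have hsupp := SimpleGraph.Walk.support_ofSupport hne hchain
  have hham : (SimpleGraph.Walk.ofSupport m hne hchain).IsHamiltonian := by
    intro D
    rw [hsupp]
    exact List.count_eq_one_of_mem hnodup (hall D)
  refine ⟨_, _, SimpleGraph.Walk.ofSupport m hne hchain, hham, hham.map _ φ.bijective, fun l => ?_⟩
  rw [hsupp]
  constructor
  · intro h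
    refine h.eq ?_ hπ₀ hgen
    rintro _ ⟨D, rfl⟩
    exact nodup_encode _
  · rintro rfl
    exact hgen
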